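/- Let $n,m,s\ge 0$ be integers with $s+m\le n$, and let $V$ be a complex vector space of dimension $n$. Let $$\mathcal N=\{(A,B)\in \mathrm{Hom}(V,\mathbb C^s)\times \mathrm{Hom}(\mathbb C^m,V) \mid AB=0\},$$ let $$\mathcal F=\mathcal F(m,n-s,V)=\{(U_1,U_2)\mid U_1\subset U_2\subset V,\ \dim U_1=m,\ \dim U_2=n-s\}$$ be the partial flag variety, and let $$\widetilde{\mathcal N}=\{(A,B,U_1,U_2)\in\mathcal N\times\mathcal F \mid \operatorname{Im}B\subset U_1\subset U_2\subset\ker A\},$$ a subvariety of $\mathcal N\times\mathcal F$, with projection $\pi:\widetilde{\mathcal N}\to\mathcal F$, $(A,B,U_1,U_2)\mapsto(U_1,U_2)$. The fibers of $\pi$ are linear subspaces of $\mathrm{Hom}(V,\mathbb C^s)\times \mathrm{Hom}(\mathbb C^m,V)$. Let $$\mathcal K=\underline{\mathbb C^m}\otimes\mathrm{Taut}\ \oplus\ \underline{\mathbb C^s}\otimes\mathcal Q^*,$$ where $\underline{\mathbb C^m},\underline{\mathbb C^s}$ are the trivial bundles over $\mathcal F$, $\mathrm{Taut}=\{(u,U_1,U_2)\mid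 u\in U_1\}\subset V\times\mathcal F$ is the tautological bundle, and $\mathcal Q^*=\{(v,U_1,U_2)\mid v\in (V/U_2)^*\}\subset V^*\times\mathcal F$ is the dual quotient bundle. Then $\pi:\widetilde{\mathcal N}\to\mathcal F$ and $\mathcal K\to\mathcal F$ are algebraic vector bundles of rank $m^2+s^2$, and they are isomorphic as algebraic vector bundles over $\mathcal F$: there is an isomorphism of varieties $\widetilde{\mathcal N}\cong\mathcal K$ that commutes with the projections to $\mathcal F$ and is linear on every fiber. In particular, $\widetilde{\mathcal N}$ is a (nonempty) smooth variety of dimension $sn+mn-sm$: all of its local rings are regular of dimension $sn+mn-sm$. -/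

import Mathlib

open Topology TensorProduct

noncomputable section

/-! ### Complex spaces with functions

Classical complex varieties are treated as spaces with functions: a topological space together with
a sheaf of complex valued functions. A sheaf of functions is recorded by saying which functions are
regular at which points; a function is a regular function on an open set `U` when it is
regular at every point of `U`. Functions are total, and only their germs matter. -/

/-- A space with functions over `ℂ`: a topology and a sheaf of `ℂ`-algebras of functions such
that the non-vanishing locus of a regular function is open and its inverse is regular there. -/
structure FunctionSpace (X : Type*) where
  top : TopologicalSpace X
  RegularAt : (X → ℂ) → X → Prop
  regularAt_const : ∀ (c : ℂ) (x : X), RegularAt (fun _ => c) x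
  regularAt_add : ∀ {f g : X → ℂ} {x : X},
    RegularAt f x → RegularAt g x → RegularAt (f + g) x
  regularAt_mul : ∀ {f g : X → ℂ} {x : X},
    RegularAt f x → RegularAt g x → RegularAt (f * g) x
  regularAt_inv : ∀ {f : X → ℂ} {x : X}, RegularAt f x → f x ≠ 0 → RegularAt f⁻¹ x
  eventually_ne : ∀ {f : X → ℂ} {x : X}, RegularAt f x → f x ≠ 0 → ∀ᶠ y in @nhds X top x, f y ≠ 0
  regularAt_congr : ∀ {f g : X → ℂ} {x : X},
    (∀ᶠ y in @nhds X top x, f y = g y) → RegularAt f x → RegularAt g x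
  eventually_regularAt : ∀ {f : X → ℂ} {x : X},
    RegularAt f x → ∀ᶠ y in @nhds X top x, RegularAt f y

namespace FunctionSpace

variable {X Y Z : Type*}

/-- `f` is a regular function on the set `U` (meant for open `U`). -/
def RegularOn (S : FunctionSpace X) (f : X → ℂ) (U : Set X) : Prop :=
  ∀ x ∈ U, S.RegularAt f x

/-- A morphism is a continuous map that pulls back regular functions to regular functions. -/
def IsMorphism (S : FunctionSpace X) (T : FunctionSpace Y) (φ : X → Y) : Prop :=
  @Continuous X Y S.top T.top φ ∧
    ∀ (x : X) (g : Y → ℂ), T.RegularAt g (φ x) → S.RegularAt (g ∘ φ) x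

/-- An isomorphism: a bijection that is a morphism in both directions. -/
def IsIsomorphism (S : FunctionSpace X) (T : FunctionSpace Y) (e : X ≃ Y) : Prop :=
  S.IsMorphism T e ∧ T.IsMorphism S e.symm

/-- The structure induced on `X` by a map `j : X → Y` (used for inclusions of subsets): the
topology is the induced one, and the regular functions are locally the restrictions of regular
functions of `Y`. -/
def induced (T : FunctionSpace Y) (j : X → Y) : FunctionSpace X where
  top := TopologicalSpace.induced j T.top
  RegularAt f x := ∃ g : Y → ℂ, T.RegularAt g (j x) ∧
    ∀ᶠ y in @nhds X (TopologicalSpace.induced j T.top) x, f y = g (j y)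
  regularAt_const c x := ⟨fun _ => c, T.regularAt_const c _, Filter.Eventually.of_forall fun _ => rfl⟩
  regularAt_add := by
    rintro f g x ⟨f', hf, hf'⟩ ⟨g', hg, hg'⟩
    refine ⟨f' + g', T.regularAt_add hf hg, ?_⟩
    filter_upwards [hf', hg'] with y h1 h2
    simp [h1, h2]
  regularAt_mul := by
    rintro f g x ⟨f', hf, hf'⟩ ⟨g', hg, hg'⟩
    refine ⟨f' * g', T.regularAt_mul hf hg, ?_⟩
    filter_upwards [hf', hg'] with y h1 h2
    simp [h1, h2]
  regularAt_inv := by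
    rintro f x ⟨f', hf, hf'⟩ hx
    have hxx := @Filter.Eventually.self_of_nhds X (TopologicalSpace.induced j T.top) _ _ hf'
    refine ⟨f'⁻¹, T.regularAt_inv hf (hxx ▸ hx), ?_⟩
    filter_upwards [hf'] with y h1
    simp [h1]
  eventually_ne := by
    rintro f x ⟨f', hf, hf'⟩ hx
    have hxx := @Filter.Eventually.self_of_nhds X (TopologicalSpace.induced j T.top) _ _ hf'
    have h2 := T.eventually_ne hf (hxx ▸ hx)
    have h3 : ∀ᶠ y in @nhds X (TopologicalSpace.induced j T.top) x, f' (j y) ≠ 0 := by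
      let _ := T.top
      rw [nhds_induced]
      exact h2.comap j
    filter_upwards [hf', h3] with y h4 h5
    rwa [h4]
  regularAt_congr := by
    rintro f g x hfg ⟨f', hf, hf'⟩
    refine ⟨f', hf, ?_⟩
    filter_upwards [hfg, hf'] with y h1 h2
    rw [← h1, h2]
  eventually_regularAt := by
    rintro f x ⟨f', hf, hf'⟩
    let _ := T.top
    let _ := TopologicalSpace.induced j T.top
    have h3 : ∀ᶠ y in 𝓝 x, T.RegularAt f' (j y) := by
      rw [nhds_induced]
      exact (T.eventually_regularAt hf).comap j
    filter_upwards [eventually_eventually_nhds.2 hf', h3] with y h4 h5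
    exact ⟨f', h5, h4⟩

/-- The quotient structure on `Y` along a (surjective) map `p : X → Y`: the quotient topology, and
a function is regular near `y` when its pullback is regular on the preimage of an open
neighbourhood of `y`. -/
def quotient (S : FunctionSpace X) (p : X → Y) : FunctionSpace Y where
  top := TopologicalSpace.coinduced p S.top
  RegularAt f y := ∀ᶠ z in @nhds Y (TopologicalSpace.coinduced p S.top) y,
    ∀ x, p x = z → S.RegularAt (f ∘ p) x
  regularAt_const c y := Filter.Eventually.of_forall fun _ x _ => S.regularAt_const c x
  regularAt_add := by
    intro f g y hf hg
    filter_upwards [hf, hg] with z h1 h2 x hx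
    exact S.regularAt_add (h1 x hx) (h2 x hx)
  regularAt_mul := by
    intro f g y hf hg
    filter_upwards [hf, hg] with z h1 h2 x hx
    exact S.regularAt_mul (h1 x hx) (h2 x hx)
  regularAt_inv := by
    intro f y hf hy
    let _ := S.top
    let _ := TopologicalSpace.coinduced p S.top
    have hne : ∀ᶠ z in 𝓝 y, f z ≠ 0 := by
      obtain ⟨U, hU, hUo, hyU⟩ := eventually_nhds_iff.1 hf
      refine eventually_nhds_iff.2 ⟨{z | z ∈ U ∧ f z ≠ 0}, fun z hz => hz.2, ?_, hyU, hy⟩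
      rw [isOpen_coinduced, isOpen_iff_mem_nhds]
      rintro x ⟨hxU, hx⟩
      filter_upwards [(isOpen_coinduced.1 hUo).mem_nhds hxU,
        S.eventually_ne (hU _ hxU x rfl) hx] with w h1 h2
      exact ⟨h1, h2⟩
    filter_upwards [hf, hne] with z h1 h2 x hx
    exact S.regularAt_inv (h1 x hx) (by simpa [hx] using h2)
  eventually_ne := by
    intro f y hf hy
    let _ := S.top
    let _ := TopologicalSpace.coinduced p S.top
    obtain ⟨U, hU, hUo, hyU⟩ := eventually_nhds_iff.1 hf
    refine eventually_nhds_iff.2 ⟨{z | z ∈ U ∧ f z ≠ 0}, fun z hz => hz.2, ?_, hyU, hy⟩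
    rw [isOpen_coinduced, isOpen_iff_mem_nhds]
    rintro x ⟨hxU, hx⟩
    filter_upwards [(isOpen_coinduced.1 hUo).mem_nhds hxU,
      S.eventually_ne (hU _ hxU x rfl) hx] with w h1 h2
    exact ⟨h1, h2⟩
  regularAt_congr := by
    intro f g y hfg hf
    let _ := S.top
    let _ := TopologicalSpace.coinduced p S.top
    filter_upwards [hf, eventually_eventually_nhds.2 hfg] with z h1 h2 x hx
    refine S.regularAt_congr ?_ (h1 x hx)
    have hc : Continuous p := continuous_coinduced_rng
    have := hc.continuousAt (x := x)
    rw [ContinuousAt, hx] at this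
    exact this.eventually h2
  eventually_regularAt := by
    intro f y hf
    let _ := TopologicalSpace.coinduced p S.top
    exact eventually_eventually_nhds.2 hf

/-- The structure generated by a directed family of algebras of functions `A i`, where the functions
of `A i` are only considered on the set `W i`: the sets `{x ∈ W i | h x ≠ 0}`, `h ∈ A i`, generate
the topology, and a function is regular when it is locally a quotient of two functions of some
`A i`. -/
def generated {ι : Type*} (W : ι → Set X) (A : ι → Subalgebra ℂ (X → ℂ))
    (dir : ∀ i j, ∃ k, W i ∩ W j ⊆ W k ∧ A i ≤ A k ∧ A j ≤ A k)
    (cover : ∀ x, ∃ i, x ∈ W i) : FunctionSpace X :=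
  let τ : TopologicalSpace X :=
    TopologicalSpace.generateFrom {D | ∃ i, ∃ h ∈ A i, D = {x | x ∈ W i ∧ h x ≠ 0}}
  have key : ∀ (i : ι) (h : X → ℂ) (x : X), h ∈ A i → x ∈ W i → h x ≠ 0 →
      ∀ᶠ y in @nhds X τ x, y ∈ W i ∧ h y ≠ 0 := fun i h x hA hW hx =>
    @IsOpen.mem_nhds X τ x {x | x ∈ W i ∧ h x ≠ 0}
      (TopologicalSpace.isOpen_generateFrom_of_mem ⟨i, h, hA, rfl⟩) ⟨hW, hx⟩
  { top := τ
    RegularAt := fun f x => ∃ i, x ∈ W i ∧ ∃ a ∈ A i, ∃ b ∈ A i, b x ≠ 0 ∧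
      ∀ᶠ y in @nhds X τ x, f y = a y / b y
    regularAt_const := fun c x => by
      obtain ⟨i, hi⟩ := cover x
      refine ⟨i, hi, fun _ => c, (A i).algebraMap_mem c, 1, (A i).one_mem, by simp, ?_⟩
      exact Filter.Eventually.of_forall fun y => by simp
    regularAt_add := by
      rintro f g x ⟨i, hi, a, ha, b, hb, hbx, hf⟩ ⟨j, hj, c, hc, d, hd, hdx, hg⟩
      obtain ⟨k, hW, hik, hjk⟩ := dir i j
      refine ⟨k, hW ⟨hi, hj⟩, a * d + b * c, (A k).add_mem ((A k).mul_mem (hik ha) (hjk hd))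
        ((A k).mul_mem (hik hb) (hjk hc)), b * d, (A k).mul_mem (hik hb) (hjk hd),
        mul_ne_zero hbx hdx, ?_⟩
      filter_upwards [hf, hg, key i b x hb hi hbx, key j d x hd hj hdx] with y h1 h2 h3 h4
      have h5 := h3.2
      have h6 := h4.2
      simp only [Pi.add_apply, Pi.mul_apply, h1, h2]
      field_simp
    regularAt_mul := by
      rintro f g x ⟨i, hi, a, ha, b, hb, hbx, hf⟩ ⟨j, hj, c, hc, d, hd, hdx, hg⟩
      obtain ⟨k, hW, hik, hjk⟩ := dir i j
      refine ⟨k, hW ⟨hi, hj⟩, a * c, (A k).mul_mem (hik ha) (hjk hc), b * d,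
        (A k).mul_mem (hik hb) (hjk hd), mul_ne_zero hbx hdx, ?_⟩
      filter_upwards [hf, hg] with y h1 h2
      simp only [Pi.mul_apply, h1, h2]
      exact div_mul_div_comm _ _ _ _
    regularAt_inv := by
      rintro f x ⟨i, hi, a, ha, b, hb, hbx, hf⟩ hx
      have hxx := @Filter.Eventually.self_of_nhds X τ _ _ hf
      refine ⟨i, hi, b, hb, a, ha, fun h0 => hx (by simp [hxx, h0]), ?_⟩
      filter_upwards [hf] with y h1
      simp [h1]
    eventually_ne := by
      rintro f x ⟨i, hi, a, ha, b, hb, hbx, hf⟩ hx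
      have hxx := @Filter.Eventually.self_of_nhds X τ _ _ hf
      have hax : a x ≠ 0 := fun h0 => hx (by simp [hxx, h0])
      filter_upwards [hf, key i a x ha hi hax, key i b x hb hi hbx] with y h1 h2 h3
      rw [h1]
      exact div_ne_zero h2.2 h3.2
    regularAt_congr := by
      rintro f g x hfg ⟨i, hi, a, ha, b, hb, hbx, hf⟩
      refine ⟨i, hi, a, ha, b, hb, hbx, ?_⟩
      filter_upwards [hfg, hf] with y h1 h2
      rw [← h1, h2]
    eventually_regularAt := by
      rintro f x ⟨i, hi, a, ha, b, hb, hbx, hf⟩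
      filter_upwards [(@eventually_eventually_nhds X τ _ _).2 hf, key i b x hb hi hbx] with y h1 h2
      exact ⟨i, h2.1, a, ha, b, hb, h2.2, h1⟩ }

/-- The algebra of polynomial functions on a finite dimensional complex vector space. -/
def polynomialFunctions (E : Type*) [AddCommGroup E] [Module ℂ E] : Subalgebra ℂ (E → ℂ) :=
  Algebra.adjoin ℂ (Set.range fun l : Module.Dual ℂ E => (l : E → ℂ))

/-- A finite dimensional complex vector space as an affine space, with the Zariski topology and
functions that are locally quotients of polynomials. -/
def affineSpace (E : Type*) [AddCommGroup E] [Module ℂ E] : FunctionSpace E :=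
  generated (ι := Unit) (fun _ => Set.univ) (fun _ => polynomialFunctions E)
    (fun _ _ => ⟨(), Set.subset_univ _, le_rfl, le_rfl⟩) (fun _ => ⟨(), trivial⟩)

/-- The algebra generated by the functions `f(x)` and `g(y)` on `X × Y`, where `f` is regular on
`U` and `g` is regular on `V`. -/
def productFunctions (S : FunctionSpace X) (T : FunctionSpace Y) (U : Set X) (V : Set Y) :
    Subalgebra ℂ (X × Y → ℂ) :=
  Algebra.adjoin ℂ ({h | ∃ f, S.RegularOn f U ∧ h = f ∘ Prod.fst} ∪
    {h | ∃ g, T.RegularOn g V ∧ h = g ∘ Prod.snd})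

/-- The product of two spaces with functions: the open sets are generated by the sets
`{(x, y) ∈ U × V | ∑ fᵢ(x) gᵢ(y) ≠ 0}` with `fᵢ`, `gᵢ` regular on the open sets `U`, `V`, and the
regular functions are locally quotients of functions of the form `∑ fᵢ(x) gᵢ(y)`. -/
def prod (S : FunctionSpace X) (T : FunctionSpace Y) : FunctionSpace (X × Y) :=
  generated (ι := {U : Set X // IsOpen[S.top] U} × {V : Set Y // IsOpen[T.top] V})
    (fun i => i.1.1 ×ˢ i.2.1) (fun i => productFunctions S T i.1.1 i.2.1)
    (fun i j => by
      let _ := S.top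
      let _ := T.top
      refine ⟨(⟨i.1.1 ∩ j.1.1, i.1.2.inter j.1.2⟩,
        ⟨i.2.1 ∩ j.2.1, i.2.2.inter j.2.2⟩), ?_, ?_, ?_⟩
      · rintro ⟨x, y⟩ ⟨⟨h1, h2⟩, ⟨h3, h4⟩⟩
        exact ⟨⟨h1, h3⟩, ⟨h2, h4⟩⟩
      · refine Algebra.adjoin_mono (Set.union_subset_union ?_ ?_)
        · rintro h ⟨f, hf, rfl⟩
          exact ⟨f, fun x hx => hf x hx.1, rfl⟩
        · rintro h ⟨f, hf, rfl⟩
          exact ⟨f, fun x hx => hf x hx.1, rfl⟩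
      · refine Algebra.adjoin_mono (Set.union_subset_union ?_ ?_)
        · rintro h ⟨f, hf, rfl⟩
          exact ⟨f, fun x hx => hf x hx.2, rfl⟩
        · rintro h ⟨f, hf, rfl⟩
          exact ⟨f, fun x hx => hf x hx.2, rfl⟩)
    (fun x => ⟨(⟨Set.univ, @isOpen_univ X S.top⟩, ⟨Set.univ, @isOpen_univ Y T.top⟩),
      ⟨trivial, trivial⟩⟩)

/-- The local ring of `S` at `x`: germs at `x` of functions regular at `x`. -/
def localRing (S : FunctionSpace X) (x : X) : Subring (Filter.Germ (@nhds X S.top x) ℂ) where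
  carrier := {γ | ∃ f : X → ℂ, S.RegularAt f x ∧ (f : Filter.Germ (@nhds X S.top x) ℂ) = γ}
  mul_mem' := by
    rintro _ _ ⟨f, hf, rfl⟩ ⟨g, hg, rfl⟩
    exact ⟨f * g, S.regularAt_mul hf hg, rfl⟩
  one_mem' := ⟨fun _ => 1, S.regularAt_const 1 x, rfl⟩
  add_mem' := by
    rintro _ _ ⟨f, hf, rfl⟩ ⟨g, hg, rfl⟩
    exact ⟨f + g, S.regularAt_add hf hg, rfl⟩
  zero_mem' := ⟨fun _ => 0, S.regularAt_const 0 x, rfl⟩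
  neg_mem' := by
    rintro _ ⟨f, hf, rfl⟩
    refine ⟨(fun _ => -1) * f, S.regularAt_mul (S.regularAt_const (-1) x) hf, ?_⟩
    have : (fun _ => (-1 : ℂ)) * f = -f := by
      funext y
      simp
    rw [this]
    rfl

/-- An affine variety: isomorphic to a Zariski closed subset of some `ℂᴺ`. -/
def IsAffineVariety (S : FunctionSpace X) : Prop :=
  ∃ (N : ℕ) (C : Set (Fin N → ℂ)), IsClosed[(affineSpace (Fin N → ℂ)).top] C ∧
    ∃ e : X ≃ C, S.IsIsomorphism ((affineSpace (Fin N → ℂ)).induced (Subtype.val : C → _)) e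

/-- A variety (not necessarily irreducible): a separated space with functions with a finite cover
by open affine varieties. -/
def IsVariety (S : FunctionSpace X) : Prop :=
  (∃ 𝒰 : Set (Set X), 𝒰.Finite ∧ ⋃₀ 𝒰 = Set.univ ∧ ∀ U ∈ 𝒰, IsOpen[S.top] U ∧
    (S.induced (Subtype.val : U → X)).IsAffineVariety) ∧
  IsClosed[(S.prod S).top] (Set.diagonal X)

/-- A (nonempty) smooth variety of dimension `d`: all local rings are regular of dimension `d`. -/
def IsSmoothVarietyOfDim (S : FunctionSpace X) (d : ℕ) : Prop :=
  Nonempty X ∧ S.IsVariety ∧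
    ∀ x, IsRegularLocalRing (S.localRing x) ∧ ringKrullDim (S.localRing x) = d

end FunctionSpace

/-! ### Algebraic vector bundles -/

/-- The fiber of `π` over `b`. -/
def Fiber {X B : Type*} (π : X → B) (b : B) : Type _ := {x : X // π x = b}

def Fiber.mk {X B : Type*} {π : X → B} {b : B} (x : X) (h : π x = b) : Fiber π b := ⟨x, h⟩

/-- `π : X → B`, with vector space structures on its fibers, is an algebraic vector bundle of rank
`r`: locally on `B` there is an isomorphism `π⁻¹(U) ≅ U × ℂʳ` of spaces with functions over `U`
that is linear on every fiber. -/
def IsVectorBundle {X B : Type*} (SX : FunctionSpace X) (SB : FunctionSpace B) (π : X → B)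
    [∀ b, AddCommGroup (Fiber π b)] [∀ b, Module ℂ (Fiber π b)] (r : ℕ) : Prop :=
  ∀ b₀ : B, ∃ U : Set B, b₀ ∈ U ∧ IsOpen[SB.top] U ∧
    ∃ ψ : (π ⁻¹' U : Set X) ≃ U × (Fin r → ℂ),
      (SX.induced Subtype.val).IsIsomorphism
        ((SB.induced Subtype.val).prod (FunctionSpace.affineSpace (Fin r → ℂ))) ψ ∧
      (∀ x, ((ψ x).1 : B) = π x) ∧
      ∀ (b : B) (hb : b ∈ U), IsLinearMap ℂ fun z : Fiber π b =>
        (ψ ⟨z.1, show π z.1 ∈ U from z.2.symm ▸ hb⟩).2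

/-- `Φ : X ≃ Y` is an isomorphism of vector bundles over `B`: an isomorphism of spaces with
functions that commutes with the projections and is linear on every fiber. -/
def IsVectorBundleIso {X Y B : Type*} (SX : FunctionSpace X) (SY : FunctionSpace Y)
    (πX : X → B) (πY : Y → B)
    [∀ b, AddCommGroup (Fiber πX b)] [∀ b, Module ℂ (Fiber πX b)]
    [∀ b, AddCommGroup (Fiber πY b)] [∀ b, Module ℂ (Fiber πY b)] (Φ : X ≃ Y) : Prop :=
  SX.IsIsomorphism SY Φ ∧
    ∃ h : ∀ x, πY (Φ x) = πX x,
      ∀ b, IsLinearMap ℂ fun z : Fiber πX b => (Fiber.mk (Φ z.1) ((h z.1).trans z.2) : Fiber πY b)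

/-- The total space `{(w, b) | w ∈ E b} ⊆ W × B` of a family `E` of subspaces of `W`. -/
def TotalSpace {W B : Type*} [AddCommGroup W] [Module ℂ W] (E : B → Submodule ℂ W) : Type _ :=
  {p : W × B // p.1 ∈ E p.2}

namespace TotalSpace

variable {W B : Type*} [AddCommGroup W] [Module ℂ W] (E : B → Submodule ℂ W)

def proj (x : TotalSpace E) : B := x.1.2

/-- The total space has the structure induced from `W × B`. -/
def space (SB : FunctionSpace B) : FunctionSpace (TotalSpace E) :=
  ((FunctionSpace.affineSpace W).prod SB).induced Subtype.val

/-- The fiber over `b` is `E b`. -/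
def fiberEquiv (b : B) : Fiber (proj E) b ≃ E b where
  toFun z := ⟨z.1.1.1, by
    have h := z.1.2
    rwa [show z.1.1.2 = b from z.2] at h⟩
  invFun w := ⟨⟨(w.1, b), w.2⟩, rfl⟩
  left_inv := by
    rintro ⟨⟨⟨w, b'⟩, hw⟩, h⟩
    cases (h : b' = b)
    rfl
  right_inv _ := rfl

instance (b : B) : AddCommGroup (Fiber (proj E) b) := (fiberEquiv E b).addCommGroup

instance (b : B) : Module ℂ (Fiber (proj E) b) := (fiberEquiv E b).module ℂ

end TotalSpace

/-- The tensor product of the trivial bundle with fiber `M` and the bundle `E ⊆ W × B`: the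
subbundle of the trivial bundle with fiber `M ⊗ W` with fibers `M ⊗ E b`. -/
def trivialTensor (M : Type*) [AddCommGroup M] [Module ℂ M] {W B : Type*} [AddCommGroup W]
    [Module ℂ W] (E : B → Submodule ℂ W) (b : B) : Submodule ℂ (M ⊗[ℂ] W) :=
  LinearMap.range (LinearMap.lTensor M (E b).subtype)

/-- The direct sum of two bundles `E ⊆ W × B` and `E' ⊆ W' × B`. -/
def bundleSum {W W' B : Type*} [AddCommGroup W] [Module ℂ W] [AddCommGroup W'] [Module ℂ W']
    (E : B → Submodule ℂ W) (E' : B → Submodule ℂ W') (b : B) : Submodule ℂ (W × W') :=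
  (E b).prod (E' b)

/-! ### Grassmannians and flag varieties -/

section Flags

variable (V : Type*) [AddCommGroup V] [Module ℂ V]

/-- The Grassmannian of `k`-dimensional subspaces of `V`. -/
def Gr (k : ℕ) : Type _ := {U : Submodule ℂ V // Module.finrank ℂ U = k}

/-- The `k`-frames in `V`: injective linear maps `ℂᵏ → V`. -/
def Frame (k : ℕ) : Type _ := {T : (Fin k → ℂ) →ₗ[ℂ] V // Function.Injective T}

def Frame.span {k : ℕ} (T : Frame V k) : Gr V k :=
  ⟨LinearMap.range T.1, by rw [LinearMap.finrank_range_of_inj T.2]; simp⟩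

/-- The Grassmannian as the quotient of the open set of frames in `Hom(ℂᵏ, V)` by `GL_k`. -/
def Gr.space (k : ℕ) : FunctionSpace (Gr V k) :=
  FunctionSpace.quotient
    ((FunctionSpace.affineSpace ((Fin k → ℂ) →ₗ[ℂ] V)).induced (Subtype.val : Frame V k → _))
    (Frame.span V)

/-- The partial flag variety of pairs `U₁ ⊆ U₂ ⊆ V` with `dim U₁ = k` and `dim U₂ = l`. -/
def Flag₂ (k l : ℕ) : Type _ := {p : Gr V k × Gr V l // p.1.1 ≤ p.2.1}

variable {V} in
def Flag₂.fst {k l : ℕ} (p : Flag₂ V k l) : Submodule ℂ V := p.1.1.1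

variable {V} in
def Flag₂.snd {k l : ℕ} (p : Flag₂ V k l) : Submodule ℂ V := p.1.2.1

/-- The flag variety as a subvariety of the product of two Grassmannians. -/
def Flag₂.space (k l : ℕ) : FunctionSpace (Flag₂ V k l) :=
  ((Gr.space V k).prod (Gr.space V l)).induced Subtype.val

/-- The tautological bundle `{(u, U₁, U₂) | u ∈ U₁} ⊆ V × Flag`. -/
def taut (k l : ℕ) (p : Flag₂ V k l) : Submodule ℂ V := p.fst

/-- The dual quotient bundle `{(v, U₁, U₂) | v ∈ (V / U₂)*} ⊆ V* × Flag`, where `(V / U₂)*` is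
embedded in `V*` by composition with `V → V / U₂`. -/
def dualQuotient (k l : ℕ) (p : Flag₂ V k l) : Submodule ℂ (Module.Dual ℂ V) :=
  LinearMap.range p.snd.mkQ.dualMap

/-- The bundle `𝒦 = ℂᵐ ⊗ Taut ⊕ ℂˢ ⊗ 𝒬*` over the flag variety. -/
def bundleK (m s k l : ℕ) :
    Flag₂ V k l → Submodule ℂ (((Fin m → ℂ) ⊗[ℂ] V) × ((Fin s → ℂ) ⊗[ℂ] Module.Dual ℂ V)) :=
  bundleSum (trivialTensor (Fin m → ℂ) (taut V k l))
    (trivialTensor (Fin s → ℂ) (dualQuotient V k l))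

/-! ### The null cone and the variety `Ñ` -/

variable (m s : ℕ)

/-- `Hom(V, ℂˢ) × Hom(ℂᵐ, V)`. -/
abbrev HomPair : Type _ := (V →ₗ[ℂ] (Fin s → ℂ)) × ((Fin m → ℂ) →ₗ[ℂ] V)

/-- The map `φ(A, B) = AB`. -/
def phi (p : HomPair V m s) : (Fin m → ℂ) →ₗ[ℂ] (Fin s → ℂ) := p.1 ∘ₗ p.2

/-- The null cone `𝒩 = φ⁻¹(0)`. -/
def NullCone : Type _ := {p : HomPair V m s // phi V m s p = 0}

def NullCone.space : FunctionSpace (NullCone V m s) :=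
  (FunctionSpace.affineSpace (HomPair V m s)).induced Subtype.val

variable (k l : ℕ)

/-- `Ñ = {(A, B, U₁, U₂) ∈ 𝒩 × Flag | Im B ⊆ U₁ ⊆ U₂ ⊆ ker A}`. -/
def NTilde : Type _ :=
  {q : NullCone V m s × Flag₂ V k l //
    LinearMap.range q.1.1.2 ≤ q.2.fst ∧ q.2.snd ≤ LinearMap.ker q.1.1.1}

namespace NTilde

/-- `Ñ` as a subvariety of `𝒩 × Flag`. -/
def space : FunctionSpace (NTilde V m s k l) :=
  ((NullCone.space V m s).prod (Flag₂.space V k l)).induced Subtype.val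

/-- The projection `(A, B, U₁, U₂) ↦ (U₁, U₂)`. -/
def proj (x : NTilde V m s k l) : Flag₂ V k l := x.1.2

/-- The linear subspace of pairs `(A, B)` with `Im B ⊆ U₁` and `U₂ ⊆ ker A`. -/
def fiberSubmodule (p : Flag₂ V k l) : Submodule ℂ (HomPair V m s) where
  carrier := {c | LinearMap.range c.2 ≤ p.fst ∧ p.snd ≤ LinearMap.ker c.1}
  add_mem' := by
    rintro a b ⟨ha, ha'⟩ ⟨hb, hb'⟩
    refine ⟨?_, fun v hv => ?_⟩
    · rintro _ ⟨v, rfl⟩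
      exact p.fst.add_mem (ha ⟨v, rfl⟩) (hb ⟨v, rfl⟩)
    · have h1 := LinearMap.mem_ker.1 (ha' hv)
      have h2 := LinearMap.mem_ker.1 (hb' hv)
      simp [h1, h2]
  zero_mem' := by
    refine ⟨?_, fun v _ => by simp⟩
    rintro _ ⟨v, rfl⟩
    simp
  smul_mem' := by
    rintro c a ⟨ha, ha'⟩
    refine ⟨?_, fun v hv => ?_⟩
    · rintro _ ⟨v, rfl⟩
      exact p.fst.smul_mem c (ha ⟨v, rfl⟩)
    · have h1 := LinearMap.mem_ker.1 (ha' hv)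
      simp [h1]

/-- The fiber of `Ñ` over `(U₁, U₂)` is this linear subspace of `Hom(V, ℂˢ) × Hom(ℂᵐ, V)`. -/
def fiberEquiv (p : Flag₂ V k l) : Fiber (proj V m s k l) p ≃ fiberSubmodule V m s k l p where
  toFun z := ⟨z.1.1.1.1, by
    have h := z.1.2
    rwa [show z.1.1.2 = p from z.2] at h⟩
  invFun c := ⟨⟨(⟨c.1, by
    refine LinearMap.ext fun v => ?_
    exact LinearMap.mem_ker.1 (c.2.2 (p.2 (c.2.1 ⟨v, rfl⟩)))⟩, p), c.2⟩, rfl⟩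
  left_inv := by
    rintro ⟨⟨⟨c, p'⟩, hc⟩, h⟩
    cases (h : p' = p)
    rfl
  right_inv _ := rfl

instance (p : Flag₂ V k l) : AddCommGroup (Fiber (proj V m s k l) p) :=
  (fiberEquiv V m s k l p).addCommGroup

instance (p : Flag₂ V k l) : Module ℂ (Fiber (proj V m s k l) p) :=
  (fiberEquiv V m s k l p).module ℂ

end NTilde

end Flags

end

/-! Over a flag `U₁ ⊆ U₂` the fiber of `Ñ` is `Hom(V/U₂, ℂˢ) × Hom(ℂᵐ, U₁)`. The fixed linear
isomorphisms `Hom(ℂᵐ, V) ≃ ℂᵐ ⊗ V` and `Hom(V, ℂˢ) ≃ ℂˢ ⊗ V*` carry it onto the fiber of `𝒦`. They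
do not depend on the flag, so they give an isomorphism of total spaces that is regular in both
directions (`isVectorBundleIso_nTildeEquivBundleK`). Local triviality is proved for `Ñ` and
transported to `𝒦` by `IsVectorBundle.of_iso`.

Put `l = n - s` and `k = n - s - m`, and choose coordinates `V ≃ ℂˡ × ℂˢ` and `ℂˡ ≃ ℂᵐ × ℂᵏ`. On the
open set of flags whose members project isomorphically to `ℂˡ` and `ℂᵐ`, `U₂` is the graph of a map
`ℂˡ → ℂˢ`, and inside it `U₁` is given by a map `ℂᵐ → ℂᵏ`. Over this set, `B` is determined by its
projection to `ℂᵐ`, and `A` by its restriction to the complement `0 × ℂˢ` of `U₂`. Hence the rank is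
`m² + s²`, and `Ñ` has charts isomorphic to affine space of dimension `mk + ls + m² + s² = sn + mn -
sm`. Finitely many charts suffice, because complements can be spanned by vectors of one fixed basis.

The analytic content is that the section of a projection with image `U` depends regularly on `U`
(`Gr.isMorphismAt_sect`): on frames it is given by Cramer's rule, and it descends to the quotient.
The same sections show that Grassmannians are separated. Smoothness reduces to the local rings of
`ℂᵈ`, which are localizations of a polynomial ring at maximal ideals of height `d`. -/

open FunctionSpace

namespace FunctionSpace

variable {X Y Z : Type*}

/-! ### Morphisms at a point -/

/-- `φ` is continuous at `x` and pulls back functions regular at `φ x` to functions regular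
at `x`. -/
def IsMorphismAt (S : FunctionSpace X) (T : FunctionSpace Y) (φ : X → Y) (x : X) : Prop :=
  Filter.Tendsto φ (@nhds X S.top x) (@nhds Y T.top (φ x)) ∧
    ∀ g : Y → ℂ, T.RegularAt g (φ x) → S.RegularAt (g ∘ φ) x

theorem isMorphism_iff {S : FunctionSpace X} {T : FunctionSpace Y} {φ : X → Y} :
    S.IsMorphism T φ ↔ ∀ x, S.IsMorphismAt T φ x := by
  let _ := S.top
  let _ := T.top
  constructor
  · rintro ⟨h1, h2⟩ x
    exact ⟨h1.tendsto x, h2 x⟩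
  · intro h
    exact ⟨continuous_iff_continuousAt.2 fun x => (h x).1, fun x => (h x).2⟩

theorem IsMorphism.at {S : FunctionSpace X} {T : FunctionSpace Y} {φ : X → Y}
    (h : S.IsMorphism T φ) (x : X) : S.IsMorphismAt T φ x :=
  isMorphism_iff.1 h x

theorem IsMorphismAt.comp {S : FunctionSpace X} {T : FunctionSpace Y} {R : FunctionSpace Z}
    {φ : X → Y} {ψ : Y → Z} {x : X} (hψ : T.IsMorphismAt R ψ (φ x))
    (hφ : S.IsMorphismAt T φ x) : S.IsMorphismAt R (fun x => ψ (φ x)) x :=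
  ⟨hψ.1.comp hφ.1, fun g hg => hφ.2 (g ∘ ψ) (hψ.2 g hg)⟩

theorem isMorphismAt_id (S : FunctionSpace X) (x : X) : S.IsMorphismAt S (fun x => x) x :=
  ⟨Filter.tendsto_id, fun _ hg => hg⟩

theorem IsMorphismAt.congr {S : FunctionSpace X} {T : FunctionSpace Y} {φ ψ : X → Y} {x : X}
    (h : S.IsMorphismAt T φ x) (he : ∀ᶠ y in @nhds X S.top x, φ y = ψ y) :
    S.IsMorphismAt T ψ x := by
  have hx : φ x = ψ x := @Filter.Eventually.self_of_nhds X S.top _ _ he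
  refine ⟨?_, fun g hg => ?_⟩
  · rw [← hx]
    exact h.1.congr' he
  · refine S.regularAt_congr ?_ (h.2 g (hx ▸ hg))
    filter_upwards [he] with y hy
    simp [hy]

theorem isMorphismAt_induced {T : FunctionSpace Y} (j : X → Y) (x : X) :
    (T.induced j).IsMorphismAt T j x := by
  let _ := T.top
  refine ⟨?_, fun g hg => ⟨g, hg, Filter.Eventually.of_forall fun _ => rfl⟩⟩
  exact (@Continuous.tendsto X Y (TopologicalSpace.induced j T.top) _ _ continuous_induced_dom x)

/-- The universal property of the induced structure. Morphisms into frames, flags, `Ñ` and total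
spaces are all tested in an ambient space through it. -/
theorem isMorphismAt_induced_iff {S : FunctionSpace Z} {T : FunctionSpace Y} {j : X → Y}
    {φ : Z → X} {z : Z} :
    S.IsMorphismAt (T.induced j) φ z ↔ S.IsMorphismAt T (fun z => j (φ z)) z := by
  refine ⟨fun h => (isMorphismAt_induced j _).comp h, fun h => ?_⟩
  have hc : Filter.Tendsto φ (@nhds Z S.top z)
      (@nhds X (TopologicalSpace.induced j T.top) (φ z)) := by
    let _ := T.top
    rw [nhds_induced, Filter.tendsto_comap_iff]
    exact h.1
  refine ⟨hc, ?_⟩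
  rintro f ⟨g, hg, hfg⟩
  refine S.regularAt_congr ?_ (h.2 g hg)
  filter_upwards [hc.eventually hfg] with y hy
  exact hy.symm

/-- The functions regular at `x`. -/
def regularSubalgebra (S : FunctionSpace X) (x : X) : Subalgebra ℂ (X → ℂ) where
  carrier := {f | S.RegularAt f x}
  mul_mem' := S.regularAt_mul
  add_mem' := S.regularAt_add
  algebraMap_mem' c := S.regularAt_const c x

theorem mem_regularSubalgebra {S : FunctionSpace X} {x : X} {f : X → ℂ} :
    f ∈ S.regularSubalgebra x ↔ S.RegularAt f x := Iff.rfl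

theorem tendsto_generateFrom_nhds {β : Type*} {g : Set (Set β)} {b : β} {α : Type*} {l : Filter α}
    {φ : α → β} (h : ∀ D ∈ g, b ∈ D → ∀ᶠ a in l, φ a ∈ D) :
    Filter.Tendsto φ l (@nhds β (TopologicalSpace.generateFrom g) b) := by
  rw [TopologicalSpace.nhds_generateFrom]
  refine Filter.tendsto_iInf.2 fun D => Filter.tendsto_iInf.2 fun hD => ?_
  exact Filter.tendsto_principal.2 (h D hD.2 hD.1)

/-- A map to a generated space is a morphism at `x` if it is continuous at `x` for the sets `W i`
and pulls back the functions of those `A i` with `φ x ∈ W i` to functions regular at `x`. -/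
theorem isMorphismAt_generated {S : FunctionSpace X} {ι : Type*} {W : ι → Set Y}
    {A : ι → Subalgebra ℂ (Y → ℂ)} {dir : ∀ i j, ∃ k, W i ∩ W j ⊆ W k ∧ A i ≤ A k ∧ A j ≤ A k}
    {cover : ∀ x, ∃ i, x ∈ W i} {φ : X → Y} {x : X}
    (hW : ∀ i, φ x ∈ W i → ∀ᶠ y in @nhds X S.top x, φ y ∈ W i)
    (hA : ∀ i, φ x ∈ W i → ∀ f ∈ A i, S.RegularAt (f ∘ φ) x) :
    S.IsMorphismAt (generated W A dir cover) φ x := by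
  have hc : Filter.Tendsto φ (@nhds X S.top x) (@nhds Y (generated W A dir cover).top (φ x)) := by
    refine tendsto_generateFrom_nhds ?_
    rintro _ ⟨i, h, hh, rfl⟩ ⟨hx, hx'⟩
    filter_upwards [hW i hx, S.eventually_ne (hA i hx h hh) hx'] with y h1 h2
    exact ⟨h1, h2⟩
  refine ⟨hc, ?_⟩
  rintro g ⟨i, hi, a, ha, b, hb, hbx, he⟩
  have h1 : S.RegularAt ((a ∘ φ) * (b ∘ φ)⁻¹) x :=
    S.regularAt_mul (hA i hi a ha) (S.regularAt_inv (hA i hi b hb) hbx)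
  refine S.regularAt_congr ?_ h1
  filter_upwards [hc.eventually he] with y hy
  simp only [Pi.mul_apply, Pi.inv_apply, Function.comp_apply, hy, div_eq_mul_inv]

theorem regularAt_generated {ι : Type*} {W : ι → Set Y}
    {A : ι → Subalgebra ℂ (Y → ℂ)} {dir : ∀ i j, ∃ k, W i ∩ W j ⊆ W k ∧ A i ≤ A k ∧ A j ≤ A k}
    {cover : ∀ x, ∃ i, x ∈ W i} (i : ι) {h : Y → ℂ} (hh : h ∈ A i) {y : Y} (hy : y ∈ W i) :
    (generated W A dir cover).RegularAt h y :=
  ⟨i, hy, h, hh, 1, (A i).one_mem, by simp, Filter.Eventually.of_forall fun y => by simp⟩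

/-! ### Products -/

theorem RegularAt.exists_isOpen {S : FunctionSpace X} {f : X → ℂ} {x : X} (h : S.RegularAt f x) :
    ∃ U : Set X, IsOpen[S.top] U ∧ x ∈ U ∧ S.RegularOn f U := by
  let _ := S.top
  obtain ⟨U, hU, hUo, hx⟩ := eventually_nhds_iff.1 (S.eventually_regularAt h)
  exact ⟨U, hUo, hx, hU⟩

theorem isOpen_prod {S : FunctionSpace X} {T : FunctionSpace Y} {U : Set X} {V : Set Y}
    (hU : IsOpen[S.top] U) (hV : IsOpen[T.top] V) : IsOpen[(S.prod T).top] (U ×ˢ V) := by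
  -- A box is the basic open set of the constant function `1`.
  have : U ×ˢ V = {p | p ∈ U ×ˢ V ∧ (1 : X × Y → ℂ) p ≠ 0} := by
    ext p
    simp
  rw [this]
  exact TopologicalSpace.isOpen_generateFrom_of_mem
    ⟨(⟨U, hU⟩, ⟨V, hV⟩), 1, one_mem (productFunctions S T U V), rfl⟩

theorem regularAt_prod {S : FunctionSpace X} {T : FunctionSpace Y} {U : Set X} {V : Set Y}
    (hU : IsOpen[S.top] U) (hV : IsOpen[T.top] V) {h : X × Y → ℂ}
    (hh : h ∈ productFunctions S T U V) {p : X × Y} (hp : p ∈ U ×ˢ V) :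
    (S.prod T).RegularAt h p :=
  ⟨(⟨U, hU⟩, ⟨V, hV⟩), hp, h, hh, 1, one_mem _, by simp,
    Filter.Eventually.of_forall fun y => by simp⟩

theorem isMorphismAt_fst (S : FunctionSpace X) (T : FunctionSpace Y) (p : X × Y) :
    (S.prod T).IsMorphismAt S Prod.fst p := by
  let _ := S.top
  let _ := T.top
  let _ := (S.prod T).top
  constructor
  · refine Filter.tendsto_def.2 fun N hN => ?_
    obtain ⟨U, hUN, hU, hp⟩ := mem_nhds_iff.1 hN
    exact mem_nhds_iff.2 ⟨U ×ˢ Set.univ, fun y hy => hUN hy.1, isOpen_prod hU isOpen_univ, hp,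
      trivial⟩
  · intro g hg
    obtain ⟨U, hU, hx, hgU⟩ := RegularAt.exists_isOpen hg
    exact regularAt_prod hU isOpen_univ (Algebra.subset_adjoin (Or.inl ⟨g, hgU, rfl⟩))
      ⟨hx, trivial⟩

theorem isMorphismAt_snd (S : FunctionSpace X) (T : FunctionSpace Y) (p : X × Y) :
    (S.prod T).IsMorphismAt T Prod.snd p := by
  let _ := S.top
  let _ := T.top
  let _ := (S.prod T).top
  constructor
  · refine Filter.tendsto_def.2 fun N hN => ?_
    obtain ⟨U, hUN, hU, hp⟩ := mem_nhds_iff.1 hN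
    exact mem_nhds_iff.2 ⟨Set.univ ×ˢ U, fun y hy => hUN hy.2, isOpen_prod isOpen_univ hU,
      trivial, hp⟩
  · intro g hg
    obtain ⟨U, hU, hx, hgU⟩ := RegularAt.exists_isOpen hg
    exact regularAt_prod isOpen_univ hU (Algebra.subset_adjoin (Or.inr ⟨g, hgU, rfl⟩))
      ⟨trivial, hx⟩

/-- The universal property of the product. Regular functions form an algebra, so it is enough to
pull back the generators `f(x)` and `g(y)`. -/
theorem isMorphismAt_prod_iff {R : FunctionSpace Z} {S : FunctionSpace X} {T : FunctionSpace Y}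
    {φ : Z → X × Y} {z : Z} : R.IsMorphismAt (S.prod T) φ z ↔
      R.IsMorphismAt S (fun z => (φ z).1) z ∧ R.IsMorphismAt T (fun z => (φ z).2) z := by
  refine ⟨fun h => ⟨(isMorphismAt_fst S T _).comp h, (isMorphismAt_snd S T _).comp h⟩, ?_⟩
  rintro ⟨h1, h2⟩
  refine isMorphismAt_generated ?_ ?_
  · rintro ⟨U, V⟩ ⟨hU, hV⟩
    let _ := S.top
    let _ := T.top
    filter_upwards [h1.1 (IsOpen.mem_nhds U.2 hU), h2.1 (IsOpen.mem_nhds V.2 hV)] with y hy1 hy2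
    exact ⟨hy1, hy2⟩
  · rintro ⟨U, V⟩ ⟨hU, hV⟩ f hf
    induction hf using Algebra.adjoin_induction with
    | mem f hf =>
      rcases hf with ⟨g, hg, rfl⟩ | ⟨g, hg, rfl⟩
      · exact h1.2 g (hg _ hU)
      · exact h2.2 g (hg _ hV)
    | algebraMap c => exact R.regularAt_const c z
    | add f g _ _ hf hg => exact R.regularAt_add hf hg
    | mul f g _ _ hf hg => exact R.regularAt_mul hf hg

theorem IsMorphismAt.prodMk {R : FunctionSpace Z} {S : FunctionSpace X} {T : FunctionSpace Y}
    {φ : Z → X} {ψ : Z → Y} {z : Z} (h1 : R.IsMorphismAt S φ z) (h2 : R.IsMorphismAt T ψ z) :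
    R.IsMorphismAt (S.prod T) (fun z => (φ z, ψ z)) z :=
  isMorphismAt_prod_iff.2 ⟨h1, h2⟩

/-! ### Quotients -/

theorem isMorphismAt_quotient (S : FunctionSpace X) (p : X → Y) (x : X) :
    S.IsMorphismAt (S.quotient p) p x := by
  refine ⟨(@Continuous.tendsto X Y S.top (TopologicalSpace.coinduced p S.top) _
    (@continuous_coinduced_rng _ _ p S.top) x), fun g hg => ?_⟩
  exact @Filter.Eventually.self_of_nhds Y (TopologicalSpace.coinduced p S.top) _ _ hg x rfl

theorem isOpen_quotient_iff {S : FunctionSpace X} {p : X → Y} {U : Set Y} :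
    IsOpen[(S.quotient p).top] U ↔ IsOpen[S.top] (p ⁻¹' U) := Iff.rfl

/-- Descent along a quotient, over an open set only, since it is applied to maps that are regular
just on a chart. The hypothesis concerns every point above `U` because openness and regularity
downstairs are tested on full preimages. -/
theorem IsMorphismAt.quotient {S : FunctionSpace X} {T : FunctionSpace Z} {p : X → Y}
    {φ : Y → Z} {U : Set Y} (hU : IsOpen[(S.quotient p).top] U)
    (h : ∀ x, p x ∈ U → S.IsMorphismAt T (fun x => φ (p x)) x) {y : Y} (hy : y ∈ U) :
    (S.quotient p).IsMorphismAt T φ y := by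
  let _ := S.top
  let _ := T.top
  let _ : TopologicalSpace Y := TopologicalSpace.coinduced p S.top
  have hc : Filter.Tendsto φ (𝓝 y) (𝓝 (φ y)) := by
    refine Filter.tendsto_def.2 fun N hN => ?_
    obtain ⟨O, hON, hO, hyO⟩ := mem_nhds_iff.1 hN
    refine mem_nhds_iff.2 ⟨U ∩ φ ⁻¹' O, fun z hz => hON hz.2, ?_, hy, hyO⟩
    rw [isOpen_coinduced, isOpen_iff_mem_nhds]
    rintro x ⟨hx, hx'⟩
    filter_upwards [(isOpen_coinduced.1 hU).mem_nhds hx, (h x hx).1 (hO.mem_nhds hx')] with w h1 h2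
    exact ⟨h1, h2⟩
  refine ⟨hc, fun g hg => ?_⟩
  have h1 : ∀ᶠ z in 𝓝 y, T.RegularAt g (φ z) := hc.eventually (T.eventually_regularAt hg)
  have h2 : ∀ᶠ z in 𝓝 y, z ∈ U := IsOpen.mem_nhds hU hy
  change ∀ᶠ z in 𝓝 y, _
  filter_upwards [h1, h2] with z hz hzU x hx
  subst hx
  exact (h x hzU).2 g hz

/-! ### Affine spaces -/

section Affine

variable {E F G : Type*} [AddCommGroup E] [Module ℂ E] [AddCommGroup F] [Module ℂ F]
  [AddCommGroup G] [Module ℂ G]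

theorem regularAt_polynomialFunctions {h : E → ℂ} (hh : h ∈ polynomialFunctions E) (x : E) :
    (affineSpace E).RegularAt h x :=
  regularAt_generated () hh trivial

theorem regularAt_dual (l : Module.Dual ℂ E) (x : E) : (affineSpace E).RegularAt l x :=
  regularAt_polynomialFunctions (Algebra.subset_adjoin ⟨l, rfl⟩) x

/-- Maps to affine spaces are morphisms when their coordinates are regular. -/
theorem isMorphismAt_affineSpace_iff {S : FunctionSpace X} {φ : X → E} {x : X} :
    S.IsMorphismAt (affineSpace E) φ x ↔
      ∀ l : Module.Dual ℂ E, S.RegularAt (fun y => l (φ y)) x := by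
  refine ⟨fun h l => h.2 l (regularAt_dual l _), fun h => ?_⟩
  refine isMorphismAt_generated (fun _ _ => Filter.Eventually.of_forall fun _ => trivial) ?_
  rintro - - f hf
  induction hf using Algebra.adjoin_induction with
  | mem f hf =>
    obtain ⟨l, rfl⟩ := hf
    exact h l
  | algebraMap c => exact S.regularAt_const c x
  | add f g _ _ hf hg => exact S.regularAt_add hf hg
  | mul f g _ _ hf hg => exact S.regularAt_mul hf hg

theorem isMorphismAt_const {S : FunctionSpace X} (e : E) (x : X) :
    S.IsMorphismAt (affineSpace E) (fun _ => e) x :=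
  isMorphismAt_affineSpace_iff.2 fun l => S.regularAt_const (l e) x

theorem IsMorphismAt.add {S : FunctionSpace X} {φ ψ : X → E} {x : X}
    (hφ : S.IsMorphismAt (affineSpace E) φ x) (hψ : S.IsMorphismAt (affineSpace E) ψ x) :
    S.IsMorphismAt (affineSpace E) (fun y => φ y + ψ y) x := by
  rw [isMorphismAt_affineSpace_iff] at *
  intro l
  simp only [map_add]
  exact S.regularAt_add (hφ l) (hψ l)

theorem IsMorphismAt.linear {S : FunctionSpace X} {φ : X → E} {x : X} (L : E →ₗ[ℂ] F)
    (hφ : S.IsMorphismAt (affineSpace E) φ x) :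
    S.IsMorphismAt (affineSpace F) (fun y => L (φ y)) x := by
  rw [isMorphismAt_affineSpace_iff] at *
  exact fun l => hφ (l ∘ₗ L)

theorem IsMorphismAt.sub {S : FunctionSpace X} {φ ψ : X → E} {x : X}
    (hφ : S.IsMorphismAt (affineSpace E) φ x) (hψ : S.IsMorphismAt (affineSpace E) ψ x) :
    S.IsMorphismAt (affineSpace E) (fun y => φ y - ψ y) x := by
  simp only [sub_eq_add_neg]
  exact hφ.add (hψ.linear (-LinearMap.id))

theorem isMorphismAt_affineSpace_prod_iff {S : FunctionSpace X} {φ : X → E × F} {x : X} :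
    S.IsMorphismAt (affineSpace (E × F)) φ x ↔
      S.IsMorphismAt (affineSpace E) (fun y => (φ y).1) x ∧
      S.IsMorphismAt (affineSpace F) (fun y => (φ y).2) x := by
  refine ⟨fun h => ⟨h.linear (LinearMap.fst ℂ E F), h.linear (LinearMap.snd ℂ E F)⟩, ?_⟩
  rintro ⟨h1, h2⟩
  refine ((h1.linear (LinearMap.inl ℂ E F)).add (h2.linear (LinearMap.inr ℂ E F))).congr ?_
  exact Filter.Eventually.of_forall fun y => by simp

theorem regularAt_sum {S : FunctionSpace X} {ι : Type*} (s : Finset ι) {f : ι → X → ℂ} {x : X}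
    (h : ∀ i ∈ s, S.RegularAt (f i) x) : S.RegularAt (fun y => ∑ i ∈ s, f i y) x := by
  have := (S.regularSubalgebra x).sum_mem (t := s) (f := f) h
  rw [mem_regularSubalgebra] at this
  convert this using 1
  funext y
  simp

/-- Expanding the first argument in a basis turns each coordinate of `B (φ y) (ψ y)` into a finite
sum of products of regular functions. -/
theorem IsMorphismAt.bilinear [FiniteDimensional ℂ E] {S : FunctionSpace X}
    {φ : X → E} {ψ : X → F} {x : X} (B : E →ₗ[ℂ] F →ₗ[ℂ] G)
    (hφ : S.IsMorphismAt (affineSpace E) φ x) (hψ : S.IsMorphismAt (affineSpace F) ψ x) :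
    S.IsMorphismAt (affineSpace G) (fun y => B (φ y) (ψ y)) x := by
  rw [isMorphismAt_affineSpace_iff]
  intro l
  let b := Module.finBasis ℂ E
  have : (fun y => l (B (φ y) (ψ y))) =
      fun y => ∑ i, b.coord i (φ y) * l (B (b i) (ψ y)) := by
    funext y
    conv_lhs => rw [← b.sum_repr (φ y)]
    simp only [map_sum, map_smul, LinearMap.sum_apply, LinearMap.smul_apply, smul_eq_mul,
      Module.Basis.coord_apply]
  rw [this]
  refine regularAt_sum _ fun i _ => S.regularAt_mul ?_ ?_
  · exact isMorphismAt_affineSpace_iff.1 hφ (b.coord i)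
  · exact isMorphismAt_affineSpace_iff.1 hψ (l ∘ₗ B (b i))

theorem IsMorphismAt.linearMapComp [FiniteDimensional ℂ E] [FiniteDimensional ℂ F]
    [FiniteDimensional ℂ G] {S : FunctionSpace X} {φ : X → F →ₗ[ℂ] G} {ψ : X → E →ₗ[ℂ] F} {x : X}
    (hφ : S.IsMorphismAt (affineSpace (F →ₗ[ℂ] G)) φ x)
    (hψ : S.IsMorphismAt (affineSpace (E →ₗ[ℂ] F)) ψ x) :
    S.IsMorphismAt (affineSpace (E →ₗ[ℂ] G)) (fun y => φ y ∘ₗ ψ y) x :=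
  hφ.bilinear (LinearMap.llcomp ℂ E F G) hψ

theorem isMorphismAt_pi_iff {ι : Type*} [Finite ι] {S : FunctionSpace X} {φ : X → ι → ℂ} {x : X} :
    S.IsMorphismAt (affineSpace (ι → ℂ)) φ x ↔ ∀ i, S.RegularAt (fun y => φ y i) x := by
  have := Fintype.ofFinite ι
  classical
  refine ⟨fun h i => isMorphismAt_affineSpace_iff.1 h (LinearMap.proj i), fun h => ?_⟩
  rw [isMorphismAt_affineSpace_iff]
  intro l
  have : (fun y => l (φ y)) = fun y => ∑ i, φ y i * l (Pi.single i 1) := by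
    funext y
    conv_lhs => rw [← (Pi.basisFun ℂ ι).sum_repr (φ y)]
    simp
  rw [this]
  exact regularAt_sum _ fun i _ => S.regularAt_mul (h i) (S.regularAt_const _ x)

end Affine

end FunctionSpace

namespace FunctionSpace

variable {X Y Z : Type*}

/-! ### Local rings -/

/-- Composition of germs with a map, as a ring homomorphism. -/
noncomputable def germComp {l : Filter X} {l' : Filter Y} (φ : X → Y) (h : Filter.Tendsto φ l l') :
    Filter.Germ l' ℂ →+* Filter.Germ l ℂ where
  toFun g := g.compTendsto φ h
  map_one' := rfl
  map_zero' := rfl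
  map_mul' f g := Filter.Germ.inductionOn₂ f g fun _ _ => rfl
  map_add' f g := Filter.Germ.inductionOn₂ f g fun _ _ => rfl

/-- The homomorphism of local rings induced by a morphism. -/
noncomputable def IsMorphismAt.localRingHom {S : FunctionSpace X} {T : FunctionSpace Y} {φ : X → Y}
    {x : X} (h : S.IsMorphismAt T φ x) : T.localRing (φ x) →+* S.localRing x :=
  ((germComp φ h.1).comp (T.localRing (φ x)).subtype).codRestrict _ (by
    rintro ⟨_, g, hg, rfl⟩
    exact ⟨g ∘ φ, h.2 g hg, rfl⟩)

/-- A morphism with a local inverse induces an isomorphism of local rings. -/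
theorem IsMorphismAt.localRingHom_bijective {S : FunctionSpace X} {T : FunctionSpace Y} {φ : X → Y}
    {ψ : Y → X} {x : X} (hφ : S.IsMorphismAt T φ x) (hψ : T.IsMorphismAt S ψ (φ x))
    (h1 : ∀ᶠ y in @nhds X S.top x, ψ (φ y) = y)
    (h2 : ∀ᶠ y in @nhds Y T.top (φ x), φ (ψ y) = y) :
    Function.Bijective hφ.localRingHom := by
  have hx : ψ (φ x) = x :=
    @Filter.Eventually.self_of_nhds X S.top x (fun y => ψ (φ y) = y) h1
  obtain ⟨hc, hr⟩ := hψ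
  rw [hx] at hc hr
  constructor
  · rintro ⟨_, f, hf, rfl⟩ ⟨_, g, hg, rfl⟩ he
    have he1 : ((f ∘ φ : X → ℂ) : Filter.Germ (@nhds X S.top x) ℂ) = (g ∘ φ : X → ℂ) :=
      congrArg Subtype.val he
    have he2 := Filter.Germ.coe_eq.1 he1
    refine Subtype.ext (Filter.Germ.coe_eq.2 ?_)
    filter_upwards [hc.eventually he2, h2] with y hy hy2
    simpa [hy2] using hy
  · rintro ⟨_, f, hf, rfl⟩
    refine ⟨⟨(f ∘ ψ : Y → ℂ), f ∘ ψ, hr f hf, rfl⟩, Subtype.ext (Filter.Germ.coe_eq.2 ?_)⟩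
    filter_upwards [h1] with y hy
    simp [hy]

/-! ### The local rings of affine space -/

section Affine

variable {d : ℕ}

theorem mem_polynomialFunctions_iff {f : (Fin d → ℂ) → ℂ} :
    f ∈ polynomialFunctions (Fin d → ℂ) ↔
      ∃ p : MvPolynomial (Fin d) ℂ, f = fun x => MvPolynomial.eval x p := by
  constructor
  · intro hf
    induction hf using Algebra.adjoin_induction with
    | mem f hf =>
      obtain ⟨l, rfl⟩ := hf
      refine ⟨∑ i, MvPolynomial.C (l (Pi.single i 1)) * MvPolynomial.X i, ?_⟩
      funext x
      conv_lhs => rw [← (Pi.basisFun ℂ (Fin d)).sum_repr x]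
      simp [mul_comm]
    | algebraMap c => exact ⟨MvPolynomial.C c, by funext x; simp⟩
    | add f g _ _ hf hg =>
      obtain ⟨p, rfl⟩ := hf
      obtain ⟨q, rfl⟩ := hg
      exact ⟨p + q, by funext x; simp⟩
    | mul f g _ _ hf hg =>
      obtain ⟨p, rfl⟩ := hf
      obtain ⟨q, rfl⟩ := hg
      exact ⟨p * q, by funext x; simp⟩
  · rintro ⟨p, rfl⟩
    induction p using MvPolynomial.induction_on with
    | C c =>
      simp only [MvPolynomial.eval_C]
      exact (polynomialFunctions (Fin d → ℂ)).algebraMap_mem c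
    | add p q hp hq =>
      simp only [map_add]
      exact (polynomialFunctions (Fin d → ℂ)).add_mem hp hq
    | mul_X p i hp =>
      simp only [map_mul, MvPolynomial.eval_X]
      exact (polynomialFunctions (Fin d → ℂ)).mul_mem hp
        (Algebra.subset_adjoin ⟨LinearMap.proj i, rfl⟩)

/-- Principal open sets are stable under intersection, as `D(f) ∩ D(g) = D(fg)`, so they form a
basis and not merely a generating family. -/
theorem mem_nhds_affineSpace_iff {E : Type*} [AddCommGroup E] [Module ℂ E] {x : E} {s : Set E} :
    s ∈ @nhds E (affineSpace E).top x ↔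
      ∃ h ∈ polynomialFunctions E, h x ≠ 0 ∧ {y | h y ≠ 0} ⊆ s := by
  let _ := (affineSpace E).top
  have hb : TopologicalSpace.IsTopologicalBasis
      {D : Set E | ∃ h ∈ polynomialFunctions E, D = {y | h y ≠ 0}} := by
    refine ⟨?_, ?_, ?_⟩
    · rintro _ ⟨f, hf, rfl⟩ _ ⟨g, hg, rfl⟩ y ⟨hy1, hy2⟩
      refine ⟨_, ⟨f * g, mul_mem hf hg, rfl⟩, mul_ne_zero hy1 hy2, fun z hz => ?_⟩
      exact ⟨left_ne_zero_of_mul hz, right_ne_zero_of_mul hz⟩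
    · refine Set.eq_univ_of_forall fun y => ⟨_, ⟨1, one_mem _, rfl⟩, one_ne_zero⟩
    · refine congrArg TopologicalSpace.generateFrom (Set.ext fun D => ?_)
      simp
  rw [hb.mem_nhds_iff]
  constructor
  · rintro ⟨_, ⟨h, hh, rfl⟩, hx, hs⟩
    exact ⟨h, hh, hx, hs⟩
  · rintro ⟨h, hh, hx, hs⟩
    exact ⟨_, ⟨h, hh, rfl⟩, hx, hs⟩

/-- Polynomials that agree near a point are equal. -/
theorem eq_of_eventually_eval_eq {a : Fin d → ℂ} {p q : MvPolynomial (Fin d) ℂ}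
    (h : ∀ᶠ x in @nhds _ (affineSpace (Fin d → ℂ)).top a,
      MvPolynomial.eval x p = MvPolynomial.eval x q) : p = q := by
  obtain ⟨f, hf, hfa, hs⟩ := mem_nhds_affineSpace_iff.1 h
  obtain ⟨r, rfl⟩ := mem_polynomialFunctions_iff.1 hf
  -- `p` and `q` agree where `r ≠ 0`, so this product vanishes on all of `ℂᵈ`; a polynomial over an
  -- infinite field with that property is zero.
  have h0 : (p - q) * r = 0 := by
    refine MvPolynomial.funext fun x => ?_
    by_cases hx : MvPolynomial.eval x r = 0
    · simp [hx]
    · have : MvPolynomial.eval x p = MvPolynomial.eval x q := hs hx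
      simp [this]
  have hr : r ≠ 0 := by
    rintro rfl
    simp at hfa
  exact sub_eq_zero.1 ((mul_eq_zero.1 h0).resolve_right hr)

theorem regularAt_eval (p : MvPolynomial (Fin d) ℂ) (a : Fin d → ℂ) :
    (affineSpace (Fin d → ℂ)).RegularAt (fun x => MvPolynomial.eval x p) a :=
  regularAt_polynomialFunctions (mem_polynomialFunctions_iff.2 ⟨p, rfl⟩) a

/-- The germ of a polynomial at a point. -/
noncomputable def polynomialGerm (a : Fin d → ℂ) :
    MvPolynomial (Fin d) ℂ →+* (affineSpace (Fin d → ℂ)).localRing a where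
  toFun p := ⟨((fun x => MvPolynomial.eval x p : (Fin d → ℂ) → ℂ) : Filter.Germ _ ℂ), _,
    regularAt_eval p a, rfl⟩
  map_one' := by
    simp only [map_one]
    rfl
  map_zero' := by
    simp only [map_zero]
    rfl
  map_mul' p q := by
    simp only [map_mul]
    rfl
  map_add' p q := by
    simp only [map_add]
    rfl

/-- A polynomial that does not vanish at `a` is invertible near `a`, every regular germ is by
definition a quotient of polynomials, and a polynomial is determined by its germ. -/
theorem isLocalization_localRing (a : Fin d → ℂ) (P : Ideal (MvPolynomial (Fin d) ℂ)) [P.IsPrime]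
    (hP : ∀ p, p ∈ P ↔ MvPolynomial.eval a p = 0) :
    letI := (polynomialGerm a).toAlgebra
    IsLocalization.AtPrime ((affineSpace (Fin d → ℂ)).localRing a) P := by
  let _ := (polynomialGerm a).toAlgebra
  refine ⟨?_, ?_, ?_⟩
  · rintro p
    have hp : MvPolynomial.eval a p.1 ≠ 0 := fun h => p.2 ((hP _).2 h)
    refine IsUnit.of_mul_eq_one ⟨((fun x => MvPolynomial.eval x p.1 : (Fin d → ℂ) → ℂ)⁻¹ :
      (Fin d → ℂ) → ℂ), _, regularAt_inv _ (regularAt_eval p.1 a) hp, rfl⟩ ?_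
    refine Subtype.ext (Filter.Germ.coe_eq.2 ?_)
    filter_upwards [eventually_ne _ (regularAt_eval p.1 a) hp] with x hx
    exact mul_inv_cancel₀ hx
  · rintro ⟨_, f, ⟨-, -, u, hu, v, hv, hva, he⟩, rfl⟩
    obtain ⟨p, rfl⟩ := mem_polynomialFunctions_iff.1 hu
    obtain ⟨q, rfl⟩ := mem_polynomialFunctions_iff.1 hv
    refine ⟨⟨p, ⟨q, fun h => hva ((hP q).1 h)⟩⟩, Subtype.ext (Filter.Germ.coe_eq.2 ?_)⟩
    filter_upwards [he, eventually_ne _ (regularAt_eval q a) hva] with x hx hq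
    change f x * MvPolynomial.eval x q = MvPolynomial.eval x p
    rw [hx, div_mul_cancel₀ _ hq]
  · intro p q h
    have := eq_of_eventually_eval_eq (Filter.Germ.coe_eq.1 (congrArg Subtype.val h))
    exact ⟨1, by rw [this]⟩

-- The translation `X i ↦ X i + (a i - b i)` is an automorphism of the polynomial ring that pulls
-- the ideal of `b` back to the ideal of `a`.
open MvPolynomial in
theorem height_vanishingIdeal_eq (a b : Fin d → ℂ) :
    (vanishingIdeal ℂ {a} : Ideal (MvPolynomial (Fin d) ℂ)).height =
      (vanishingIdeal ℂ {b} : Ideal (MvPolynomial (Fin d) ℂ)).height := by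
  let t (c : Fin d → ℂ) : MvPolynomial (Fin d) ℂ →ₐ[ℂ] MvPolynomial (Fin d) ℂ :=
    aeval fun i => X i + C (c i)
  have ht (c c' : Fin d → ℂ) (h : c + c' = 0) : (t c).comp (t c') = AlgHom.id ℂ _ := by
    refine MvPolynomial.algHom_ext fun i => ?_
    have : c i + c' i = 0 := congrFun h i
    simp [t, add_assoc, ← C_add, this]
  let e : MvPolynomial (Fin d) ℂ ≃ₐ[ℂ] MvPolynomial (Fin d) ℂ :=
    AlgEquiv.ofAlgHom (t (a - b)) (t (b - a)) (ht _ _ (by simp)) (ht _ _ (by simp))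
  have he : (vanishingIdeal ℂ {a} : Ideal (MvPolynomial (Fin d) ℂ)) =
      (vanishingIdeal ℂ {b}).comap e.toRingEquiv := by
    have h1 : (aeval b).comp (t (a - b)) = (aeval a : MvPolynomial (Fin d) ℂ →ₐ[ℂ] ℂ) := by
      refine MvPolynomial.algHom_ext fun i => ?_
      simp [t]
    ext p
    have h2 : aeval b (t (a - b) p) = aeval a p := DFunLike.congr_fun h1 p
    rw [Ideal.mem_comap, mem_vanishingIdeal_singleton_iff, mem_vanishingIdeal_singleton_iff, ← h2]
    rfl
  rw [he, RingEquiv.height_comap]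

-- The Krull dimension `d` is the supremum of the heights of maximal ideals. By the Nullstellensatz
-- these are the ideals of points, and by translation their heights all agree, so each equals `d`.
open MvPolynomial in
theorem height_vanishingIdeal (a : Fin d → ℂ) :
    (vanishingIdeal ℂ {a} : Ideal (MvPolynomial (Fin d) ℂ)).height = d := by
  have h1 := Ideal.sup_isMaximal_height_eq_ringKrullDim (R := MvPolynomial (Fin d) ℂ)
  rw [MvPolynomial.ringKrullDim_of_isNoetherianRing, ringKrullDim_eq_zero_of_field] at h1
  have h2 : (⨆ (I : Ideal (MvPolynomial (Fin d) ℂ)) (_ : I.IsMaximal), I.height) =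
      (vanishingIdeal ℂ {a} : Ideal (MvPolynomial (Fin d) ℂ)).height := by
    refine le_antisymm (iSup₂_le fun I hI => ?_) ?_
    · obtain ⟨b, rfl⟩ := isMaximal_iff_eq_vanishingIdeal_singleton.1 hI
      exact (height_vanishingIdeal_eq b a).le
    · exact le_iSup₂_of_le _ (isMaximal_iff_eq_vanishingIdeal_singleton.2 ⟨a, rfl⟩) le_rfl
  rw [h2] at h1
  simp only [Nat.card_eq_fintype_card, Fintype.card_fin, zero_add] at h1
  exact_mod_cast h1

theorem isRegularLocalRing_affineSpace (a : Fin d → ℂ) :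
    IsRegularLocalRing ((affineSpace (Fin d → ℂ)).localRing a) ∧
      ringKrullDim ((affineSpace (Fin d → ℂ)).localRing a) = d := by
  let P : Ideal (MvPolynomial (Fin d) ℂ) := MvPolynomial.vanishingIdeal ℂ {a}
  have : P.IsMaximal := MvPolynomial.isMaximal_iff_eq_vanishingIdeal_singleton.2 ⟨a, rfl⟩
  let _ := (polynomialGerm a).toAlgebra
  have := isLocalization_localRing a P fun p => by
    simp [P]
  refine ⟨?_, ?_⟩
  · exact IsRegularLocalRing.of_ringEquiv (R := Localization.AtPrime P)
      (IsLocalization.algEquiv P.primeCompl _ _).toRingEquiv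
  · rw [IsLocalization.AtPrime.ringKrullDim_eq_height P, height_vanishingIdeal]
    rfl

end Affine

end FunctionSpace

namespace FunctionSpace

variable {X : Type*}

/-! ### Regularity of determinants and inverses -/

/-- The family of matrices is read as a single matrix over the ring of functions, whose determinant
is a polynomial in regular entries. -/
theorem regularAt_det {ι : Type*} [Fintype ι] [DecidableEq ι] {S : FunctionSpace X}
    {M : X → Matrix ι ι ℂ} {x : X} (h : ∀ i j, S.RegularAt (fun y => M y i j) x) :
    S.RegularAt (fun y => (M y).det) x := by
  have : (fun y => (M y).det) = (Matrix.of fun i j y => M y i j : Matrix ι ι (X → ℂ)).det := by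
    funext y
    exact ((Pi.evalRingHom (fun _ : X => ℂ) y).map_det
      (Matrix.of fun i j y => M y i j : Matrix ι ι (X → ℂ))).symm
  rw [this, Matrix.det_apply, ← mem_regularSubalgebra]
  exact sum_mem fun σ _ => zsmul_mem (prod_mem fun i _ => h _ _) _

/-- Cramer's rule: an entry of the inverse is a quotient of two determinants. -/
theorem regularAt_inv_apply {ι : Type*} [Fintype ι] [DecidableEq ι] {S : FunctionSpace X}
    {M : X → Matrix ι ι ℂ} {x : X} (h : ∀ i j, S.RegularAt (fun y => M y i j) x)
    (hx : (M x).det ≠ 0) (i j : ι) : S.RegularAt (fun y => (M y)⁻¹ i j) x := by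
  have : (fun y => (M y)⁻¹ i j) =
      (fun y => (M y).det)⁻¹ * fun y => ((M y).updateRow j (Pi.single i 1)).det := by
    funext y
    simp [Matrix.inv_def, Matrix.adjugate_apply]
  rw [this]
  refine S.regularAt_mul (S.regularAt_inv (regularAt_det h) hx) (regularAt_det fun a b => ?_)
  simp only [Matrix.updateRow_apply]
  split_ifs
  · exact S.regularAt_const _ x
  · exact h a b

theorem isOpen_ne_zero {S : FunctionSpace X} {f : X → ℂ} (h : ∀ x, S.RegularAt f x) :
    IsOpen[S.top] {x | f x ≠ 0} := by
  let _ := S.top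
  exact isOpen_iff_mem_nhds.2 fun x hx => S.eventually_ne (h x) hx

end FunctionSpace


/-! ### Charts of Grassmannians -/

namespace Gr

variable {V : Type*} [AddCommGroup V] [Module ℂ V] {k : ℕ}

/-- `T` is a section of `p` with image `U`. -/
def IsSection (p : V →ₗ[ℂ] (Fin k → ℂ)) (U : Gr V k) (T : (Fin k → ℂ) →ₗ[ℂ] V) : Prop :=
  p ∘ₗ T = LinearMap.id ∧ LinearMap.range T = U.1

/-- The subspaces that `p` maps isomorphically to `ℂᵏ`. -/
def chart (p : V →ₗ[ℂ] (Fin k → ℂ)) : Set (Gr V k) := {U | ∃ T, IsSection p U T}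

open Classical in
/-- The section of `p` with image `U`, for `U` in the chart of `p`. -/
noncomputable def sect (p : V →ₗ[ℂ] (Fin k → ℂ)) (U : Gr V k) : (Fin k → ℂ) →ₗ[ℂ] V :=
  if h : U ∈ chart p then h.choose else 0

variable {p : V →ₗ[ℂ] (Fin k → ℂ)} {U : Gr V k}

theorem isSection_sect (h : U ∈ chart p) : IsSection p U (sect p U) := by
  rw [sect, dif_pos h]
  exact h.choose_spec

/-- Both maps have image `U`, and a vector of `U` is determined by its image under `p`. -/
theorem IsSection.eq {T T' : (Fin k → ℂ) →ₗ[ℂ] V} (h : IsSection p U T) (h' : IsSection p U T') :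
    T = T' := by
  refine LinearMap.ext fun v => ?_
  have hv : T v ∈ LinearMap.range T' := by
    rw [h'.2, ← h.2]
    exact ⟨v, rfl⟩
  obtain ⟨w, hw⟩ := hv
  have h1 : p (T v) = v := LinearMap.congr_fun h.1 v
  have h2 : p (T' w) = w := LinearMap.congr_fun h'.1 w
  rw [← hw, h2] at h1
  rw [← hw, h1]

theorem IsSection.sect_eq {T : (Fin k → ℂ) →ₗ[ℂ] V} (h : IsSection p U T) : sect p U = T :=
  (isSection_sect ⟨T, h⟩).eq h

theorem apply_sect (h : U ∈ chart p) (v : Fin k → ℂ) : p (sect p U v) = v :=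
  LinearMap.congr_fun (isSection_sect h).1 v

theorem sect_mem (h : U ∈ chart p) (v : Fin k → ℂ) : sect p U v ∈ U.1 := by
  rw [← (isSection_sect h).2]
  exact ⟨v, rfl⟩

theorem sect_apply (h : U ∈ chart p) {u : V} (hu : u ∈ U.1) : sect p U (p u) = u := by
  rw [← (isSection_sect h).2] at hu
  obtain ⟨v, rfl⟩ := hu
  rw [apply_sect h]

theorem exists_frame (U : Gr V k) [FiniteDimensional ℂ V] : ∃ T : Frame V k, T.span = U := by
  let e : (Fin k → ℂ) ≃ₗ[ℂ] U.1 := LinearEquiv.ofFinrankEq _ _ (by simp [U.2])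
  refine ⟨⟨U.1.subtype ∘ₗ e.toLinearMap, ?_⟩, Subtype.ext ?_⟩
  · exact U.1.injective_subtype.comp e.injective
  · simp [Frame.span, LinearMap.range_comp]

/-- The chart of `p` consists of the complements of the kernel of `p`. -/
theorem mem_chart_of_disjoint [FiniteDimensional ℂ V] (h : Disjoint U.1 (LinearMap.ker p)) :
    U ∈ chart p := by
  let q : U.1 →ₗ[ℂ] (Fin k → ℂ) := p ∘ₗ U.1.subtype
  have hq : Function.Injective q := by
    rw [← LinearMap.ker_eq_bot, LinearMap.ker_eq_bot']
    intro u hu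
    exact Subtype.ext (Submodule.disjoint_def.1 h u u.2 hu)
  let e : U.1 ≃ₗ[ℂ] (Fin k → ℂ) := LinearEquiv.ofInjectiveOfFinrankEq q hq (by simp [U.2])
  refine ⟨U.1.subtype ∘ₗ e.symm.toLinearMap, LinearMap.ext fun v => ?_, ?_⟩
  · exact e.apply_symm_apply v
  · simp [LinearMap.range_comp]

theorem disjoint_of_mem_chart (h : U ∈ chart p) : Disjoint U.1 (LinearMap.ker p) := by
  rw [Submodule.disjoint_def]
  intro u hu hp
  rw [← sect_apply h hu, LinearMap.mem_ker.1 hp, map_zero]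

theorem exists_mem_chart [FiniteDimensional ℂ V] (U : Gr V k) :
    ∃ p : V →ₗ[ℂ] (Fin k → ℂ), U ∈ chart p := by
  obtain ⟨T, rfl⟩ := exists_frame U
  obtain ⟨p, hp⟩ := T.1.exists_leftInverse_of_injective (LinearMap.ker_eq_bot.2 T.2)
  exact ⟨p, T.1, hp, rfl⟩

variable (V k) in
/-- The frames as an open subset of `Hom(ℂᵏ, V)`. -/
noncomputable def frameSpace : FunctionSpace (Frame V k) :=
  (affineSpace ((Fin k → ℂ) →ₗ[ℂ] V)).induced (X := Frame V k) fun T => T.1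

theorem space_eq_quotient : Gr.space V k = (frameSpace V k).quotient (Frame.span V) := rfl

theorem isMorphismAt_frame_val (T : Frame V k) :
    (frameSpace V k).IsMorphismAt (affineSpace ((Fin k → ℂ) →ₗ[ℂ] V)) (fun T => T.1) T :=
  isMorphismAt_induced _ T

/-- An entry of the matrix of `p ∘ T` is a linear form in `T`: compose with `p`, evaluate at a basis
vector, take a coordinate. -/
theorem regularAt_det_comp [FiniteDimensional ℂ V] (p : V →ₗ[ℂ] (Fin k → ℂ)) (T : Frame V k)
    (i j : Fin k) : (frameSpace V k).RegularAt
      (fun T : Frame V k => LinearMap.toMatrix' (p ∘ₗ T.1) i j) T := by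
  exact isMorphismAt_affineSpace_iff.1 (isMorphismAt_frame_val T)
    ((LinearMap.proj i ∘ₗ LinearMap.proj (φ := fun _ => Fin k → ℂ) j) ∘ₗ
      (LinearMap.pi fun j => LinearMap.applyₗ (Pi.single j 1)) ∘ₗ LinearMap.llcomp ℂ _ _ _ p)

/-- Since `T` is injective, its image meets the kernel of `p` trivially exactly when the square
matrix of `p ∘ T` is invertible. On frames the chart is thus the nonvanishing locus of a
determinant. -/
theorem span_mem_chart_iff [FiniteDimensional ℂ V] {T : Frame V k} :
    T.span ∈ chart p ↔ (LinearMap.toMatrix' (p ∘ₗ T.1)).det ≠ 0 := by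
  rw [LinearMap.det_toMatrix']
  constructor
  · intro h
    have : LinearMap.ker (p ∘ₗ T.1) = ⊥ := by
      rw [LinearMap.ker_eq_bot']
      intro v hv
      have := Submodule.disjoint_def.1 (disjoint_of_mem_chart h) (T.1 v) ⟨v, rfl⟩ hv
      exact T.2 (this.trans (map_zero _).symm)
    exact (LinearEquiv.isUnit_det' (LinearEquiv.ofInjectiveEndo _ (LinearMap.ker_eq_bot.1 this))).ne_zero
  · intro h
    refine mem_chart_of_disjoint (Submodule.disjoint_def.2 ?_)
    rintro _ ⟨v, rfl⟩ hv
    have hk := (LinearMap.isUnit_iff_ker_eq_bot _).1 ((LinearMap.isUnit_iff_isUnit_det _).2 h.isUnit)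
    have : v = 0 := LinearMap.ker_eq_bot'.1 hk v hv
    rw [this, map_zero]

theorem isOpen_chart [FiniteDimensional ℂ V] (p : V →ₗ[ℂ] (Fin k → ℂ)) :
    IsOpen[(Gr.space V k).top] (chart p) := by
  rw [space_eq_quotient, isOpen_quotient_iff]
  have : Frame.span V ⁻¹' chart p =
      {T : Frame V k | (LinearMap.toMatrix' (p ∘ₗ T.1)).det ≠ 0} :=
    Set.ext fun T => span_mem_chart_iff
  rw [this]
  exact isOpen_ne_zero fun T => regularAt_det fun i j => regularAt_det_comp p T i j

/-- Precomposing the frame with the inverse of `p ∘ T` normalizes it to a section of `p` and keeps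
its image. This explicit formula is the source of regularity of `sect`. -/
theorem sect_span [FiniteDimensional ℂ V] {T : Frame V k} (h : T.span ∈ chart p) :
    sect p T.span = T.1 ∘ₗ Matrix.toLin' (LinearMap.toMatrix' (p ∘ₗ T.1))⁻¹ := by
  have hd := span_mem_chart_iff.1 h
  refine IsSection.sect_eq ⟨?_, ?_⟩
  · rw [← LinearMap.comp_assoc]
    conv_lhs => rw [← Matrix.toLin'_toMatrix' (p ∘ₗ T.1), ← Matrix.toLin'_mul,
      LinearMap.toMatrix'_toLin', Matrix.mul_nonsing_inv _ hd.isUnit, Matrix.toLin'_one]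
  · refine le_antisymm (LinearMap.range_comp_le_range _ _) ?_
    rintro _ ⟨v, rfl⟩
    refine ⟨Matrix.toLin' (LinearMap.toMatrix' (p ∘ₗ T.1)) v, ?_⟩
    rw [LinearMap.comp_apply, ← LinearMap.comp_apply (Matrix.toLin' _), ← Matrix.toLin'_mul,
      Matrix.nonsing_inv_mul _ hd.isUnit, Matrix.toLin'_one, LinearMap.id_apply]

/-- The section of `p` with image `U` is a regular function of `U` in the chart of `p`. -/
theorem isMorphismAt_sect [FiniteDimensional ℂ V] (h : U ∈ chart p) :
    (Gr.space V k).IsMorphismAt (affineSpace ((Fin k → ℂ) →ₗ[ℂ] V)) (sect p) U := by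
  refine IsMorphismAt.quotient (isOpen_chart p) (fun T hT => ?_) h
  have hinv : (frameSpace V k).IsMorphismAt
      (affineSpace ((Fin k → ℂ) →ₗ[ℂ] (Fin k → ℂ)))
      (fun T : Frame V k => Matrix.toLin' (LinearMap.toMatrix' (p ∘ₗ T.1))⁻¹) T := by
    have h1 : (frameSpace V k).IsMorphismAt
        (affineSpace (Fin k × Fin k → ℂ))
        (fun (T : Frame V k) (ij : Fin k × Fin k) =>
          (LinearMap.toMatrix' (p ∘ₗ T.1))⁻¹ ij.1 ij.2) T :=
      isMorphismAt_pi_iff.2 fun ij => regularAt_inv_apply (fun i j => regularAt_det_comp p T i j)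
        (span_mem_chart_iff.1 hT) ij.1 ij.2
    exact h1.linear (Matrix.toLin'.toLinearMap ∘ₗ
      (LinearEquiv.curry ℂ ℂ (Fin k) (Fin k)).toLinearMap)
  refine ((isMorphismAt_frame_val T).linearMapComp hinv).congr ?_
  have hop : IsOpen[(frameSpace V k).top] (Frame.span V ⁻¹' chart p) :=
    isOpen_quotient_iff.1 (isOpen_chart p)
  let _ := (frameSpace V k).top
  filter_upwards [hop.mem_nhds hT] with T' hT'
  exact (sect_span hT').symm

/-- The image of a family of injective maps is a regular function. -/
theorem isMorphismAt_span {Z : Type*} {S : FunctionSpace Z} {φ : Z → (Fin k → ℂ) →ₗ[ℂ] V}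
    (hφ : ∀ z, Function.Injective (φ z)) {z : Z}
    (h : S.IsMorphismAt (affineSpace ((Fin k → ℂ) →ₗ[ℂ] V)) φ z) :
    S.IsMorphismAt (Gr.space V k) (fun z => Frame.span V ⟨φ z, hφ z⟩) z := by
  have h1 : S.IsMorphismAt (frameSpace V k) (fun z => ⟨φ z, hφ z⟩) z :=
    isMorphismAt_induced_iff.2 h
  exact (isMorphismAt_quotient _ (Frame.span V) _).comp h1

theorem eventually_mem_chart [FiniteDimensional ℂ V] (h : U ∈ chart p) :
    ∀ᶠ U' in @nhds _ (Gr.space V k).top U, U' ∈ chart p := by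
  let _ := (Gr.space V k).top
  exact (isOpen_chart p).mem_nhds h

end Gr

/-! ### Separatedness -/

namespace FunctionSpace

/-- The diagonal of `X` is closed. -/
def IsSeparated {X : Type*} (S : FunctionSpace X) : Prop :=
  IsClosed[(S.prod S).top] (Set.diagonal X)

theorem isSeparated_of_eventually {X : Type*} {S : FunctionSpace X}
    (h : ∀ x y, x ≠ y → ∀ᶠ p in @nhds _ (S.prod S).top (x, y), p.1 ≠ p.2) : S.IsSeparated := by
  let _ := (S.prod S).top
  refine isOpen_compl_iff.1 (isOpen_iff_mem_nhds.2 ?_)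
  rintro ⟨x, y⟩ hxy
  exact h x y hxy

theorem IsSeparated.eventually {X : Type*} {S : FunctionSpace X} (h : S.IsSeparated) {x y : X}
    (hxy : x ≠ y) : ∀ᶠ p in @nhds _ (S.prod S).top (x, y), p.1 ≠ p.2 := by
  let _ := (S.prod S).top
  exact (isOpen_compl_iff.2 h).mem_nhds hxy

theorem IsSeparated.of_injective {X Y : Type*} {S : FunctionSpace X} {T : FunctionSpace Y}
    (h : T.IsSeparated) {j : X → Y} (hj : S.IsMorphism T j) (hinj : Function.Injective j) :
    S.IsSeparated := by
  refine isSeparated_of_eventually fun x y hxy => ?_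
  have h1 : (S.prod S).IsMorphismAt (T.prod T) (fun p => (j p.1, j p.2)) (x, y) :=
    ((hj.at x).comp (isMorphismAt_fst S S (x, y))).prodMk
      ((hj.at y).comp (isMorphismAt_snd S S (x, y)))
  filter_upwards [h1.1.eventually (h.eventually (hinj.ne hxy))] with p hp he
  exact hp (congrArg j he)

theorem IsSeparated.induced {X Y : Type*} {T : FunctionSpace Y}
    (h : T.IsSeparated) {j : X → Y} (hinj : Function.Injective j) : (T.induced j).IsSeparated :=
  h.of_injective (isMorphism_iff.2 (isMorphismAt_induced j)) hinj

theorem IsSeparated.prod {X Y : Type*} {S : FunctionSpace X} {T : FunctionSpace Y}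
    (hS : S.IsSeparated) (hT : T.IsSeparated) : (S.prod T).IsSeparated := by
  refine isSeparated_of_eventually fun x y hxy => ?_
  have hx := isMorphismAt_fst (S.prod T) (S.prod T) (x, y)
  have hy := isMorphismAt_snd (S.prod T) (S.prod T) (x, y)
  by_cases h : x.1 = y.1
  · have h2 : x.2 ≠ y.2 := fun h2 => hxy (Prod.ext h h2)
    have h1 := ((isMorphismAt_snd S T x).comp hx).prodMk ((isMorphismAt_snd S T y).comp hy)
    filter_upwards [h1.1.eventually (hT.eventually h2)] with p hp he
    exact hp (congrArg Prod.snd he)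
  · have h1 := ((isMorphismAt_fst S T x).comp hx).prodMk ((isMorphismAt_fst S T y).comp hy)
    filter_upwards [h1.1.eventually (hS.eventually h)] with p hp he
    exact hp (congrArg Prod.fst he)

theorem isSeparated_affineSpace (E : Type*) [AddCommGroup E] [Module ℂ E] :
    (affineSpace E).IsSeparated := by
  refine isSeparated_of_eventually fun x y hxy => ?_
  have h := ((isMorphismAt_fst _ _ (x, y)).sub
    (isMorphismAt_snd (affineSpace E) (affineSpace E) (x, y)))
  obtain ⟨l, hl⟩ : ∃ l : Module.Dual ℂ E, l (x - y) ≠ 0 := by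
    by_contra! hl
    exact hxy (sub_eq_zero.1 ((Module.forall_dual_apply_eq_zero_iff ℂ _).1 hl))
  filter_upwards [eventually_ne _ (isMorphismAt_affineSpace_iff.1 h l) hl] with p hp he
  simp [he] at hp

end FunctionSpace

/-- Let `P` be near `(U, U')`, with `P.1` in the chart of `p` and `P.2` in that of `q`. The map
`sect p P.1 - sect q P.2 ∘ q ∘ sect p P.1` depends regularly on `P` and vanishes when `P.1 ⊆ P.2`,
in particular on the diagonal. At `(U, U')` it is nonzero, since distinct subspaces of equal
dimension are not nested, so it stays nonzero nearby. -/
theorem Gr.isSeparated_space (V : Type*) [AddCommGroup V] [Module ℂ V] [FiniteDimensional ℂ V]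
    (k : ℕ) : (Gr.space V k).IsSeparated := by
  refine isSeparated_of_eventually fun U U' hU => ?_
  obtain ⟨p, hp⟩ := Gr.exists_mem_chart U
  obtain ⟨q, hq⟩ := Gr.exists_mem_chart U'
  have hx := isMorphismAt_fst (Gr.space V k) (Gr.space V k) (U, U')
  have hy := isMorphismAt_snd (Gr.space V k) (Gr.space V k) (U, U')
  have hs : ((Gr.space V k).prod (Gr.space V k)).IsMorphismAt (affineSpace _)
      (fun P => Gr.sect p P.1) (U, U') := (Gr.isMorphismAt_sect hp).comp hx
  have ht : ((Gr.space V k).prod (Gr.space V k)).IsMorphismAt (affineSpace _)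
      (fun P => Gr.sect q P.2) (U, U') := (Gr.isMorphismAt_sect hq).comp hy
  have h := hs.sub (ht.linearMapComp ((isMorphismAt_const q _).linearMapComp hs))
  have hne : Gr.sect p U - Gr.sect q U' ∘ₗ q ∘ₗ Gr.sect p U ≠ 0 := by
    intro h0
    have hle : U.1 ≤ U'.1 := by
      intro u hu
      have := LinearMap.congr_fun h0 (p u)
      simp only [LinearMap.sub_apply, LinearMap.comp_apply, LinearMap.zero_apply,
        Gr.sect_apply hp hu] at this
      rw [sub_eq_zero.1 this]
      exact Gr.sect_mem hq _
    exact hU (Subtype.ext (Submodule.eq_of_le_of_finrank_eq hle (U.2.trans U'.2.symm)))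
  obtain ⟨l, hl⟩ : ∃ l : Module.Dual ℂ ((Fin k → ℂ) →ₗ[ℂ] V),
      l (Gr.sect p U - Gr.sect q U' ∘ₗ q ∘ₗ Gr.sect p U) ≠ 0 := by
    by_contra! hl
    exact hne ((Module.forall_dual_apply_eq_zero_iff ℂ _).1 hl)
  filter_upwards [eventually_ne _ (isMorphismAt_affineSpace_iff.1 h l) hl,
    hx.1.eventually (Gr.eventually_mem_chart hp), hy.1.eventually (Gr.eventually_mem_chart hq)]
    with P h1 h2 h3 he
  refine h1 ?_
  rw [← he] at h3 ⊢
  have : Gr.sect p P.1 - Gr.sect q P.1 ∘ₗ q ∘ₗ Gr.sect p P.1 = 0 := by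
    refine LinearMap.ext fun v => ?_
    simp only [LinearMap.sub_apply, LinearMap.comp_apply, LinearMap.zero_apply]
    rw [Gr.sect_apply h3 (Gr.sect_mem h2 v), sub_self]
  rw [this, map_zero]

/-! ### Smooth varieties from affine charts -/

namespace FunctionSpace

/-- A separated space with a finite cover by open subsets isomorphic to `ℂᵈ` is a smooth variety
of dimension `d`. -/
theorem isSmoothVarietyOfDim_of_charts {X ι : Type*} [Finite ι] [Nonempty X] {S : FunctionSpace X}
    (hS : S.IsSeparated) (d : ℕ) (U : ι → Set X) (hU : ∀ i, IsOpen[S.top] (U i))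
    (hcover : ∀ x, ∃ i, x ∈ U i) (F : ι → (Fin d → ℂ) → X) (G : ι → X → Fin d → ℂ)
    (hF : ∀ i, (affineSpace (Fin d → ℂ)).IsMorphism S (F i))
    (hG : ∀ i, ∀ x ∈ U i, S.IsMorphismAt (affineSpace (Fin d → ℂ)) (G i) x)
    (hFU : ∀ i a, F i a ∈ U i) (hGF : ∀ i a, G i (F i a) = a)
    (hFG : ∀ i, ∀ x ∈ U i, F i (G i x) = x) : S.IsSmoothVarietyOfDim d := by
  refine ⟨inferInstance, ⟨⟨Set.range U, Set.finite_range U, ?_, ?_⟩, hS⟩, fun x => ?_⟩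
  · refine Set.eq_univ_of_forall fun x => ?_
    obtain ⟨i, hi⟩ := hcover x
    exact ⟨U i, ⟨i, rfl⟩, hi⟩
  · rintro _ ⟨i, rfl⟩
    -- The closed set that exhibits `U i` as affine is all of `ℂᵈ`.
    refine ⟨hU i, d, Set.univ, @isClosed_univ _ (affineSpace (Fin d → ℂ)).top,
      ⟨fun x => ⟨G i x.1, trivial⟩, fun a => ⟨F i a.1, hFU i a.1⟩,
        fun x => Subtype.ext (hFG i x.1 x.2), fun a => Subtype.ext (hGF i a.1)⟩, ?_, ?_⟩
    · refine isMorphism_iff.2 fun x => isMorphismAt_induced_iff.2 ?_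
      exact (hG i x.1 x.2).comp (isMorphismAt_induced _ x)
    · refine isMorphism_iff.2 fun a => isMorphismAt_induced_iff.2 ?_
      exact ((hF i).at a.1).comp (isMorphismAt_induced _ a)
  · obtain ⟨i, hi⟩ := hcover x
    have h2 : ∀ᶠ y in @nhds X S.top x, F i (G i y) = y := by
      let _ := S.top
      filter_upwards [(hU i).mem_nhds hi] with y hy
      exact hFG i y hy
    have hb := (hG i x hi).localRingHom_bijective ((hF i).at _) h2
      (Filter.Eventually.of_forall (hGF i))
    let e := RingEquiv.ofBijective _ hb
    obtain ⟨h3, h4⟩ := isRegularLocalRing_affineSpace (G i x)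
    exact ⟨IsRegularLocalRing.of_ringEquiv e, (ringKrullDim_eq_of_ringEquiv e).symm.trans h4⟩

theorem IsMorphism.comp {X Y Z : Type*} {S : FunctionSpace X} {T : FunctionSpace Y}
    {R : FunctionSpace Z} {φ : X → Y} {ψ : Y → Z} (hψ : T.IsMorphism R ψ)
    (hφ : S.IsMorphism T φ) : S.IsMorphism R fun x => ψ (φ x) :=
  isMorphism_iff.2 fun x => (hψ.at (φ x)).comp (hφ.at x)

end FunctionSpace


/-! ### Local trivializations and transport of vector bundles -/

section Bundles

variable {X Y B : Type*} {SX : FunctionSpace X} {SY : FunctionSpace Y} {SB : FunctionSpace B}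
  {πX : X → B} {πY : Y → B}

/-- A local trivialization from a fiber coordinate `f` and a parametrization `g`. -/
theorem isIsomorphism_trivialization {r : ℕ} (hπ : SX.IsMorphism SB πX) {U : Set B}
    (f : X → Fin r → ℂ) (g : U × (Fin r → ℂ) → X)
    (hf : ∀ x, πX x ∈ U → SX.IsMorphismAt (affineSpace (Fin r → ℂ)) f x)
    (hg : ((SB.induced (Subtype.val : U → B)).prod (affineSpace (Fin r → ℂ))).IsMorphism SX g)
    (h1 : ∀ q, πX (g q) = q.1) (h2 : ∀ q, f (g q) = q.2)
    (h3 : ∀ x (hx : πX x ∈ U), g (⟨πX x, hx⟩, f x) = x) :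
    ∃ ψ : (πX ⁻¹' U : Set X) ≃ U × (Fin r → ℂ),
      (SX.induced Subtype.val).IsIsomorphism
        ((SB.induced Subtype.val).prod (affineSpace (Fin r → ℂ))) ψ ∧
      ∀ x, ((ψ x).1 : B) = πX x ∧ (ψ x).2 = f x := by
  refine ⟨⟨fun x => (⟨πX x.1, x.2⟩, f x.1), fun q => ⟨g q, ?_⟩, fun x => ?_, fun q => ?_⟩,
    ⟨?_, ?_⟩, fun x => ⟨rfl, rfl⟩⟩
  · rw [Set.mem_preimage, h1]
    exact q.1.2
  · exact Subtype.ext (h3 x.1 x.2)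
  · exact Prod.ext (Subtype.ext (h1 q)) (h2 q)
  · refine isMorphism_iff.2 fun x => isMorphismAt_prod_iff.2 ⟨isMorphismAt_induced_iff.2 ?_, ?_⟩
    · exact (hπ.at x.1).comp (isMorphismAt_induced _ x)
    · exact (hf x.1 x.2).comp (isMorphismAt_induced _ x)
  · exact isMorphism_iff.2 fun q => isMorphismAt_induced_iff.2 (hg.at q)

variable [∀ b, AddCommGroup (Fiber πX b)] [∀ b, Module ℂ (Fiber πX b)]
  [∀ b, AddCommGroup (Fiber πY b)] [∀ b, Module ℂ (Fiber πY b)]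

/-- A family isomorphic to a vector bundle is a vector bundle. -/
theorem IsVectorBundle.of_iso {r : ℕ} (hX : IsVectorBundle SX SB πX r) {Φ : X ≃ Y}
    (hΦ : IsVectorBundleIso SX SY πX πY Φ) : IsVectorBundle SY SB πY r := by
  obtain ⟨⟨hΦ1, hΦ2⟩, hπ, hlin⟩ := hΦ
  have hπ' (y : Y) : πX (Φ.symm y) = πY y := by rw [← hπ, Φ.apply_symm_apply]
  intro b₀
  obtain ⟨U, hb₀, hU, ψ, ⟨hψ1, hψ2⟩, hψπ, hψl⟩ := hX b₀
  let e : (πY ⁻¹' U : Set Y) ≃ (πX ⁻¹' U : Set X) :=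
    Φ.symm.subtypeEquiv fun y => by rw [Set.mem_preimage, Set.mem_preimage, hπ']
  refine ⟨U, hb₀, hU, e.trans ψ, ⟨?_, ?_⟩, fun y => (hψπ (e y)).trans (hπ' y.1), fun b hb => ?_⟩
  · refine hψ1.comp (isMorphism_iff.2 fun y => isMorphismAt_induced_iff.2 ?_)
    exact (hΦ2.at y.1).comp (isMorphismAt_induced _ y)
  · refine isMorphism_iff.2 fun q => isMorphismAt_induced_iff.2 ?_
    exact (hΦ1.at _).comp (isMorphismAt_induced_iff.1 (hψ2.at q))
  -- Under `Φ` the new fiber coordinate becomes the old one. Every point of the fiber of `πY` is the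
  -- image of a point of the fiber of `πX`, so linearity transfers.
  · have key (z : Fiber πX b) : (e.trans ψ ⟨Φ z.1, show πY (Φ z.1) ∈ U from
        ((hπ z.1).trans z.2).symm ▸ hb⟩).2 = (ψ ⟨z.1, show πX z.1 ∈ U from z.2.symm ▸ hb⟩).2 := by
      have : e ⟨Φ z.1, show πY (Φ z.1) ∈ U from ((hπ z.1).trans z.2).symm ▸ hb⟩ =
          ⟨z.1, show πX z.1 ∈ U from z.2.symm ▸ hb⟩ := Subtype.ext (Φ.symm_apply_apply z.1)
      rw [Equiv.trans_apply, this]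
    have hsurj (y : Fiber πY b) : ∃ z : Fiber πX b,
        (Fiber.mk (Φ z.1) ((hπ z.1).trans z.2) : Fiber πY b) = y :=
      ⟨⟨Φ.symm y.1, (hπ' y.1).trans y.2⟩, Subtype.ext (Φ.apply_symm_apply y.1)⟩
    constructor
    · intro y y'
      obtain ⟨z, rfl⟩ := hsurj y
      obtain ⟨z', rfl⟩ := hsurj y'
      rw [← (hlin b).map_add]
      exact (key _).trans (((hψl b hb).map_add z z').trans (congrArg₂ _ (key z) (key z')).symm)
    · intro c y
      obtain ⟨z, rfl⟩ := hsurj y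
      rw [← (hlin b).map_smul]
      exact (key _).trans (((hψl b hb).map_smul c z).trans (congrArg _ (key z)).symm)

end Bundles

/-! ### Linear algebra -/

section LinearAlgebra

variable {V : Type*} [AddCommGroup V] [Module ℂ V]

/-- A set of basis vectors whose span meets `U` trivially can be enlarged to one whose span is a
complement of `U`. -/
theorem exists_finset_isCompl_span {ι : Type*} [Finite ι] (β : Module.Basis ι ℂ V)
    (U : Submodule ℂ V) (J₀ : Finset ι) (h : Disjoint U (Submodule.span ℂ (β '' J₀))) :
    ∃ J, J₀ ⊆ J ∧ IsCompl U (Submodule.span ℂ (β '' J)) := by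
  classical
  -- For a maximal such `J`, a basis vector outside `U ⊔ span J` could be added without losing
  -- disjointness, so there is none.
  obtain ⟨J, hJ₀, hJ⟩ := Finite.exists_le_maximal
    (p := fun J : Finset ι => Disjoint U (Submodule.span ℂ (β '' J))) h
  refine ⟨J, hJ₀, hJ.1, codisjoint_iff.2 (eq_top_iff.2 ?_)⟩
  rw [← β.span_eq, Submodule.span_le]
  rintro _ ⟨i, rfl⟩
  by_contra hi
  have hd : Disjoint U (Submodule.span ℂ (β '' (insert i J : Finset ι))) := by
    rw [Finset.coe_insert, Set.image_insert_eq, Submodule.disjoint_def]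
    intro u hu hu'
    obtain ⟨c, w, hw, rfl⟩ := Submodule.mem_span_insert.1 hu'
    have hc : c = 0 := by
      by_contra hc
      refine hi ?_
      have h1 : c • β i ∈ U ⊔ Submodule.span ℂ (β '' J) := by
        have := Submodule.sub_mem _ (Submodule.mem_sup_left (T := Submodule.span ℂ (β '' J)) hu)
          (Submodule.mem_sup_right (S := U) hw)
        rwa [add_sub_cancel_right] at this
      exact (Submodule.smul_mem_iff _ hc).1 h1
    rw [hc, zero_smul, zero_add] at hu ⊢
    exact Submodule.disjoint_def.1 hJ.1 w hu hw
  have hmem : i ∈ J := hJ.2 hd (Finset.subset_insert i J) (Finset.mem_insert_self i J)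
  exact hi (Submodule.mem_sup_right (Submodule.subset_span ⟨i, hmem, rfl⟩))

/-- Coordinates on `V` adapted to `W₂ ≤ W₁`. -/
theorem exists_equiv_adapted [FiniteDimensional ℂ V] {m k l s : ℕ}
    (r : (Fin l → ℂ) ≃ₗ[ℂ] (Fin m → ℂ) × (Fin k → ℂ)) {W₁ W₂ : Submodule ℂ V} (hW : W₂ ≤ W₁)
    (hV : Module.finrank ℂ V = m + k + s) (h₁ : Module.finrank ℂ W₁ = k + s)
    (h₂ : Module.finrank ℂ W₂ = s) :
    ∃ e : V ≃ₗ[ℂ] (Fin l → ℂ) × (Fin s → ℂ),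
      (∀ v, (e v).1 = 0 → v ∈ W₂) ∧ ∀ v, (r (e v).1).1 = 0 → v ∈ W₁ := by
  -- `V = W₂ ⊕ D ⊕ C` with `W₁ = W₂ ⊕ D` and summands of dimensions `s`, `k`, `m`. The first `l`
  -- coordinates come from `C ⊕ D` through `r`, the last `s` from `W₂`.
  obtain ⟨C, hC⟩ := W₁.exists_isCompl
  let W := W₂.comap W₁.subtype
  obtain ⟨D, hD⟩ := W.exists_isCompl
  have hWs : Module.finrank ℂ W = s := by
    rw [← h₂]
    exact (Submodule.comapSubtypeEquivOfLe hW).finrank_eq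
  have hCm : Module.finrank ℂ C = m := by
    have := Submodule.finrank_add_eq_of_isCompl hC
    lia
  have hDk : Module.finrank ℂ D = k := by
    have := Submodule.finrank_add_eq_of_isCompl hD
    lia
  let eC : C ≃ₗ[ℂ] (Fin m → ℂ) := LinearEquiv.ofFinrankEq _ _ (by simp [hCm])
  let eD : D ≃ₗ[ℂ] (Fin k → ℂ) := LinearEquiv.ofFinrankEq _ _ (by simp [hDk])
  let eW : W ≃ₗ[ℂ] (Fin s → ℂ) := LinearEquiv.ofFinrankEq _ _ (by simp [hWs])
  let f₁ := Submodule.prodEquivOfIsCompl W₁ C hC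
  let f₂ := Submodule.prodEquivOfIsCompl W D hD
  let g : V ≃ₗ[ℂ] (W × D) × C := f₁.symm.trans (f₂.symm.prodCongr (LinearEquiv.refl ℂ C))
  have hg (v : V) : v = ((g v).1.1 : W₁) + ((g v).1.2 : W₁) + (g v).2 := by
    conv_lhs => rw [← g.symm_apply_apply v]
    simp [g, f₁, f₂]
  let e : V ≃ₗ[ℂ] (Fin l → ℂ) × (Fin s → ℂ) :=
    g.trans ((LinearEquiv.prodCongr (LinearEquiv.prodComm ℂ W D) (LinearEquiv.refl ℂ C)).trans
      ((LinearEquiv.prodComm ℂ (D × W) C).trans ((LinearEquiv.prodAssoc ℂ C D W).symm.trans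
        (((eC.prodCongr eD).trans r.symm).prodCongr eW))))
  have he (v : V) : r (e v).1 = (eC (g v).2, eD (g v).1.2) := by
    simp only [e, LinearEquiv.trans_apply, LinearEquiv.prodCongr_apply,
      LinearEquiv.apply_symm_apply]
    rfl
  refine ⟨e, fun v hv => ?_, fun v hv => ?_⟩
  · have h := he v
    rw [hv, map_zero] at h
    have h3 : (g v).2 = 0 := eC.map_eq_zero_iff.1 (congrArg Prod.fst h).symm
    have h4 : (g v).1.2 = 0 := eD.map_eq_zero_iff.1 (congrArg Prod.snd h).symm
    rw [hg v, h3, h4]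
    simp only [ZeroMemClass.coe_zero, add_zero]
    exact (g v).1.1.2
  · rw [he] at hv
    have h3 : (g v).2 = 0 := eC.map_eq_zero_iff.1 hv
    rw [hg v, h3]
    simpa using W₁.add_mem (g v).1.1.1.2 (g v).1.2.1.2

theorem toDual_basisFun_apply_single {m : ℕ} (c : Fin m → ℂ) (i : Fin m) :
    (Pi.basisFun ℂ (Fin m)).toDual c (Pi.single i 1) = c i := by
  rw [← Pi.basisFun_apply, Module.Basis.toDual_apply_left, Pi.basisFun_repr]

/-- `Hom(ℂᵐ, V) ≃ ℂᵐ ⊗ V`. -/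
noncomputable def homEquivTensor (V : Type*) [AddCommGroup V] [Module ℂ V] (m : ℕ) :
    ((Fin m → ℂ) →ₗ[ℂ] V) ≃ₗ[ℂ] (Fin m → ℂ) ⊗[ℂ] V :=
  LinearEquiv.ofLinearMap
    (∑ i, TensorProduct.mk ℂ _ _ (Pi.single i 1) ∘ₗ LinearMap.applyₗ (Pi.single i 1))
    -- The inverse sends `c ⊗ v` to `w ↦ (∑ cᵢ wᵢ) v`; `toDual` supplies the bilinear pairing.
    (TensorProduct.lift (LinearMap.smulRightₗ ∘ₗ (Pi.basisFun ℂ (Fin m)).toDual))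
    (by
      refine TensorProduct.ext' fun c v => ?_
      have h (i : Fin m) : (Pi.single i 1 : Fin m → ℂ) ⊗ₜ[ℂ] (c i • v) =
          (Pi.single i (c i) : Fin m → ℂ) ⊗ₜ[ℂ] v := by
        rw [← TensorProduct.smul_tmul, ← Pi.single_smul, smul_eq_mul, mul_one]
      rw [LinearMap.comp_apply, TensorProduct.lift.tmul, LinearMap.sum_apply, LinearMap.id_apply]
      change ∑ i, Pi.single i 1 ⊗ₜ[ℂ] ((Pi.basisFun ℂ (Fin m)).toDual c (Pi.single i 1) • v) = _
      simp only [toDual_basisFun_apply_single, h]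
      rw [← TensorProduct.sum_tmul, Finset.univ_sum_single])
    (by
      refine LinearMap.ext fun T => (Pi.basisFun ℂ (Fin m)).ext fun i => ?_
      rw [LinearMap.comp_apply, LinearMap.sum_apply, map_sum, LinearMap.sum_apply,
        Pi.basisFun_apply, LinearMap.id_apply]
      change ∑ j, (Pi.basisFun ℂ (Fin m)).toDual (Pi.single j 1) (Pi.single i 1) •
        T (Pi.single j 1) = _
      simp [toDual_basisFun_apply_single, Pi.single_apply])

/-- `Hom(V, ℂˢ) ≃ ℂˢ ⊗ V*`. -/
noncomputable def homEquivTensorDual (V : Type*) [AddCommGroup V] [Module ℂ V] (s : ℕ) :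
    (V →ₗ[ℂ] (Fin s → ℂ)) ≃ₗ[ℂ] (Fin s → ℂ) ⊗[ℂ] Module.Dual ℂ V :=
  LinearEquiv.ofLinearMap
    (∑ i, TensorProduct.mk ℂ _ _ (Pi.single i 1) ∘ₗ
      LinearMap.llcomp ℂ V (Fin s → ℂ) ℂ (LinearMap.proj i))
    (TensorProduct.lift LinearMap.smulRightₗ.flip)
    (by
      refine TensorProduct.ext' fun c f => ?_
      have h (i : Fin s) : (Pi.single i 1 : Fin s → ℂ) ⊗ₜ[ℂ] (LinearMap.llcomp ℂ V (Fin s → ℂ) ℂ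
          (LinearMap.proj i) (LinearMap.smulRightₗ f c)) =
          (Pi.single i (c i) : Fin s → ℂ) ⊗ₜ[ℂ] f := by
        have : LinearMap.llcomp ℂ V (Fin s → ℂ) ℂ (LinearMap.proj i) (LinearMap.smulRightₗ f c) =
            c i • f := LinearMap.ext fun v => mul_comm _ _
        rw [this, ← TensorProduct.smul_tmul, ← Pi.single_smul, smul_eq_mul, mul_one]
      simp only [LinearMap.comp_apply, TensorProduct.lift.tmul, LinearMap.sum_apply,
        TensorProduct.mk_apply, LinearMap.flip_apply, LinearMap.id_apply, h]
      rw [← TensorProduct.sum_tmul, Finset.univ_sum_single])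
    (by
      refine LinearMap.ext fun T => LinearMap.ext fun v => ?_
      rw [LinearMap.comp_apply, LinearMap.sum_apply, map_sum, LinearMap.sum_apply,
        LinearMap.id_apply]
      change ∑ i, T v i • (Pi.single i 1 : Fin s → ℂ) = _
      simp only [← Pi.single_smul, smul_eq_mul, mul_one]
      exact Finset.univ_sum_single (T v))

/-- A pure tensor `c ⊗ u` with `u ∈ E b` corresponds to a map with values in the line of `u`.
Conversely, the tensor of `T` is the sum of the `eᵢ ⊗ T eᵢ`. -/
theorem homEquivTensor_mem_iff {B : Type*} {m : ℕ} (E : B → Submodule ℂ V) (b : B)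
    (T : (Fin m → ℂ) →ₗ[ℂ] V) :
    homEquivTensor V m T ∈ trivialTensor (Fin m → ℂ) E b ↔ LinearMap.range T ≤ E b := by
  constructor
  · rintro ⟨t, ht⟩
    have h : T = (homEquivTensor V m).symm (LinearMap.lTensor _ (E b).subtype t) := by
      rw [ht, LinearEquiv.symm_apply_apply]
    rw [h]
    clear h ht
    rintro _ ⟨v, rfl⟩
    induction t with
    | zero => simp
    | tmul c u => exact (E b).smul_mem _ u.2
    | add t t' h h' => simpa using (E b).add_mem h h'
  · intro h
    have : homEquivTensor V m T = ∑ i, (Pi.single i 1 : Fin m → ℂ) ⊗ₜ[ℂ] T (Pi.single i 1) := by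
      simp [homEquivTensor]
    rw [this]
    exact sum_mem fun i _ => ⟨Pi.single i 1 ⊗ₜ ⟨T (Pi.single i 1), h ⟨_, rfl⟩⟩, by simp⟩

/-- Inside `V*` the space `(V/U₂)*` is the annihilator of `U₂`, and `T` kills `U₂` exactly when all
its coordinate forms do. -/
theorem homEquivTensorDual_mem_iff {k l s : ℕ} (p : Flag₂ V k l) (T : V →ₗ[ℂ] (Fin s → ℂ)) :
    homEquivTensorDual V s T ∈ trivialTensor (Fin s → ℂ) (dualQuotient V k l) p ↔
      p.snd ≤ LinearMap.ker T := by
  have hmem (f : Module.Dual ℂ V) : f ∈ dualQuotient V k l p ↔ ∀ u ∈ p.snd, f u = 0 := by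
    rw [dualQuotient, Submodule.range_dualMap_mkQ_eq, Submodule.mem_dualAnnihilator]
  constructor
  · rintro ⟨t, ht⟩
    have h : T = (homEquivTensorDual V s).symm
        (LinearMap.lTensor _ (dualQuotient V k l p).subtype t) := by
      rw [ht, LinearEquiv.symm_apply_apply]
    rw [h]
    clear h ht
    intro v hv
    rw [LinearMap.mem_ker]
    induction t with
    | zero => simp
    | tmul c f =>
      change f.1 v • c = 0
      rw [(hmem f.1).1 f.2 v hv, zero_smul]
    | add t t' h h' => simp [h, h']
  · intro h
    have : homEquivTensorDual V s T =
        ∑ i, (Pi.single i 1 : Fin s → ℂ) ⊗ₜ[ℂ] (LinearMap.proj i ∘ₗ T) := by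
      change (∑ i, TensorProduct.mk ℂ _ _ (Pi.single i 1) ∘ₗ
        LinearMap.llcomp ℂ V (Fin s → ℂ) ℂ (LinearMap.proj i)) T = _
      rw [LinearMap.sum_apply]
      rfl
    rw [this]
    refine sum_mem fun i _ => ⟨Pi.single i 1 ⊗ₜ ⟨LinearMap.proj i ∘ₗ T, (hmem _).2 ?_⟩, by simp⟩
    intro u hu
    rw [LinearMap.comp_apply, LinearMap.mem_ker.1 (h hu), map_zero]

end LinearAlgebra

/-! ### Charts of flag varieties -/

section Charts

variable {V : Type*} [AddCommGroup V] [Module ℂ V] {Z : Type*} {S : FunctionSpace Z} {z : Z}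
  {m k l s : ℕ}

theorem isMorphismAt_flag_iff {φ : Z → Flag₂ V k l} :
    S.IsMorphismAt (Flag₂.space V k l) φ z ↔
      S.IsMorphismAt (Gr.space V k) (fun z => (φ z).1.1) z ∧
      S.IsMorphismAt (Gr.space V l) (fun z => (φ z).1.2) z :=
  isMorphismAt_induced_iff.trans isMorphismAt_prod_iff

theorem isMorphismAt_nTilde_iff {φ : Z → NTilde V m s k l} :
    S.IsMorphismAt (NTilde.space V m s k l) φ z ↔
      (S.IsMorphismAt (affineSpace (V →ₗ[ℂ] (Fin s → ℂ))) (fun z => (φ z).1.1.1.1) z ∧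
        S.IsMorphismAt (affineSpace ((Fin m → ℂ) →ₗ[ℂ] V)) (fun z => (φ z).1.1.1.2) z) ∧
      S.IsMorphismAt (Flag₂.space V k l) (fun z => (φ z).1.2) z :=
  isMorphismAt_induced_iff.trans (isMorphismAt_prod_iff.trans
    (and_congr_left' (isMorphismAt_induced_iff.trans isMorphismAt_affineSpace_prod_iff)))

theorem isMorphism_nTilde_proj :
    (NTilde.space V m s k l).IsMorphism (Flag₂.space V k l) (NTilde.proj V m s k l) :=
  isMorphism_iff.2 fun z => (isMorphismAt_nTilde_iff.1 (isMorphismAt_id _ z)).2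

theorem isSeparated_nTilde [FiniteDimensional ℂ V] : (NTilde.space V m s k l).IsSeparated :=
  (((isSeparated_affineSpace _).induced Subtype.val_injective).prod
    (((Gr.isSeparated_space V k).prod (Gr.isSeparated_space V l)).induced
      Subtype.val_injective)).induced Subtype.val_injective

variable (r : (Fin l → ℂ) ≃ₗ[ℂ] (Fin m → ℂ) × (Fin k → ℂ))
  (e : V ≃ₗ[ℂ] (Fin l → ℂ) × (Fin s → ℂ))

/-- The first `l` coordinates. -/
def coordSnd : V →ₗ[ℂ] (Fin l → ℂ) := LinearMap.fst ℂ _ _ ∘ₗ e.toLinearMap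

/-- The first `m` coordinates. -/
def coordFst : V →ₗ[ℂ] (Fin m → ℂ) := LinearMap.fst ℂ _ _ ∘ₗ r.toLinearMap ∘ₗ coordSnd e

/-- The flags for which both subspaces are mapped isomorphically to the first coordinates. -/
def flagChart : Set (Flag₂ V m l) :=
  {p | p.1.1 ∈ Gr.chart (coordFst r e) ∧ p.1.2 ∈ Gr.chart (coordSnd e)}

theorem isOpen_flagChart [FiniteDimensional ℂ V] :
    IsOpen[(Flag₂.space V m l).top] (flagChart r e) := by
  let _ := (Flag₂.space V m l).top
  refine isOpen_iff_mem_nhds.2 fun p hp => ?_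
  obtain ⟨h1, h2⟩ := isMorphismAt_flag_iff.1 (isMorphismAt_id (Flag₂.space V m l) p)
  exact (h1.1.eventually (Gr.eventually_mem_chart hp.1)).and
    (h2.1.eventually (Gr.eventually_mem_chart hp.2))

/-- The map `ℂˡ → V` whose image is the graph of `y`. -/
def graphMap (y : (Fin l → ℂ) →ₗ[ℂ] (Fin s → ℂ)) : (Fin l → ℂ) →ₗ[ℂ] V :=
  e.symm.toLinearMap ∘ₗ LinearMap.prod LinearMap.id y

theorem coordSnd_graphMap (y : (Fin l → ℂ) →ₗ[ℂ] (Fin s → ℂ)) :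
    coordSnd e ∘ₗ graphMap e y = LinearMap.id :=
  LinearMap.ext fun v => by simp [coordSnd, graphMap]

theorem coordFst_graphMap (x : (Fin m → ℂ) →ₗ[ℂ] (Fin k → ℂ))
    (y : (Fin l → ℂ) →ₗ[ℂ] (Fin s → ℂ)) :
    coordFst r e ∘ₗ graphMap e y ∘ₗ r.symm.toLinearMap ∘ₗ LinearMap.prod LinearMap.id x =
      LinearMap.id :=
  LinearMap.ext fun v => by simp [coordFst, coordSnd, graphMap]

/-- The flag with given coordinates. -/
def flagParam (c : ((Fin m → ℂ) →ₗ[ℂ] (Fin k → ℂ)) × ((Fin l → ℂ) →ₗ[ℂ] (Fin s → ℂ))) :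
    Flag₂ V m l :=
  ⟨(Frame.span V ⟨graphMap e c.2 ∘ₗ r.symm.toLinearMap ∘ₗ LinearMap.prod LinearMap.id c.1,
      (LinearMap.injective_of_comp_eq_id _ _ (coordFst_graphMap r e c.1 c.2))⟩,
    Frame.span V ⟨graphMap e c.2,
      (LinearMap.injective_of_comp_eq_id _ _ (coordSnd_graphMap e c.2))⟩),
    -- The frame of `U₁` factors through that of `U₂`, so the inclusion is automatic.
    LinearMap.range_comp_le_range _ _⟩

/-- The coordinates of a flag. -/
noncomputable def flagCoord (p : Flag₂ V m l) :
    ((Fin m → ℂ) →ₗ[ℂ] (Fin k → ℂ)) × ((Fin l → ℂ) →ₗ[ℂ] (Fin s → ℂ)) :=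
  (LinearMap.snd ℂ _ _ ∘ₗ r.toLinearMap ∘ₗ coordSnd e ∘ₗ Gr.sect (coordFst r e) p.1.1,
    LinearMap.snd ℂ _ _ ∘ₗ e.toLinearMap ∘ₗ Gr.sect (coordSnd e) p.1.2)

theorem isSection_flagParam_fst
    (c : ((Fin m → ℂ) →ₗ[ℂ] (Fin k → ℂ)) × ((Fin l → ℂ) →ₗ[ℂ] (Fin s → ℂ))) :
    Gr.IsSection (coordFst r e) (flagParam r e c).1.1
      (graphMap e c.2 ∘ₗ r.symm.toLinearMap ∘ₗ LinearMap.prod LinearMap.id c.1) :=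
  ⟨coordFst_graphMap r e c.1 c.2, rfl⟩

theorem isSection_flagParam_snd
    (c : ((Fin m → ℂ) →ₗ[ℂ] (Fin k → ℂ)) × ((Fin l → ℂ) →ₗ[ℂ] (Fin s → ℂ))) :
    Gr.IsSection (coordSnd e) (flagParam r e c).1.2 (graphMap e c.2) :=
  ⟨coordSnd_graphMap e c.2, rfl⟩

theorem flagParam_mem
    (c : ((Fin m → ℂ) →ₗ[ℂ] (Fin k → ℂ)) × ((Fin l → ℂ) →ₗ[ℂ] (Fin s → ℂ))) :
    flagParam r e c ∈ flagChart r e :=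
  ⟨⟨_, isSection_flagParam_fst r e c⟩, ⟨_, isSection_flagParam_snd r e c⟩⟩

theorem flagCoord_flagParam
    (c : ((Fin m → ℂ) →ₗ[ℂ] (Fin k → ℂ)) × ((Fin l → ℂ) →ₗ[ℂ] (Fin s → ℂ))) :
    flagCoord r e (flagParam r e c) = c := by
  refine Prod.ext (LinearMap.ext fun v => ?_) (LinearMap.ext fun v => ?_)
  · simp [flagCoord, (isSection_flagParam_fst r e c).sect_eq, coordSnd, graphMap]
  · simp [flagCoord, (isSection_flagParam_snd r e c).sect_eq, graphMap]

/-- The section of `U₂` is the graph map of its last coordinates. As `U₁ ⊆ U₂`, the section of `U₁`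
is recovered from its first `l` coordinates by applying the section of `U₂`. -/
theorem flagParam_flagCoord {p : Flag₂ V m l} (hp : p ∈ flagChart r e) :
    flagParam r e (flagCoord r e p) = p := by
  have h2 : graphMap e (flagCoord r e p).2 = Gr.sect (coordSnd e) p.1.2 := by
    refine LinearMap.ext fun v => e.injective (Prod.ext ?_ ?_)
    · have := Gr.apply_sect hp.2 v
      simp only [coordSnd, LinearMap.comp_apply, LinearMap.fst_apply,
        LinearEquiv.coe_coe] at this
      simp [graphMap, coordSnd, this]
    · simp [graphMap, flagCoord]
  have h1 : graphMap e (flagCoord r e p).2 ∘ₗ r.symm.toLinearMap ∘ₗ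
      LinearMap.prod LinearMap.id (flagCoord r e p).1 = Gr.sect (coordFst r e) p.1.1 := by
    rw [h2]
    refine LinearMap.ext fun v => ?_
    have h3 := Gr.sect_apply hp.2 (p.2 (Gr.sect_mem hp.1 v))
    have h4 := Gr.apply_sect hp.1 v
    simp only [coordFst, LinearMap.comp_apply, LinearMap.fst_apply, LinearEquiv.coe_coe] at h4
    rw [← h3]
    simp only [LinearMap.comp_apply, LinearEquiv.coe_coe]
    congr 1
    rw [LinearEquiv.symm_apply_eq]
    refine Prod.ext ?_ ?_
    · exact h4.symm
    · simp [flagCoord]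
  refine Subtype.ext (Prod.ext (Subtype.ext ?_) (Subtype.ext ?_))
  · exact (congrArg LinearMap.range h1).trans (Gr.isSection_sect hp.1).2
  · exact (congrArg LinearMap.range h2).trans (Gr.isSection_sect hp.2).2

theorem isMorphismAt_flagParam
    {φ : Z → ((Fin m → ℂ) →ₗ[ℂ] (Fin k → ℂ)) × ((Fin l → ℂ) →ₗ[ℂ] (Fin s → ℂ))}
    [FiniteDimensional ℂ V] (hφ : S.IsMorphismAt (affineSpace _) φ z) :
    S.IsMorphismAt (Flag₂.space V m l) (fun z => flagParam r e (φ z)) z := by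
  obtain ⟨h1, h2⟩ := isMorphismAt_affineSpace_prod_iff.1 hφ
  have hprod {a b : ℕ} {x : Z → (Fin a → ℂ) →ₗ[ℂ] (Fin b → ℂ)}
      (hx : S.IsMorphismAt (affineSpace _) x z) :
      S.IsMorphismAt (affineSpace _) (fun z => LinearMap.prod LinearMap.id (x z)) z :=
    IsMorphismAt.linear (φ := fun z => ((LinearMap.id : (Fin a → ℂ) →ₗ[ℂ] (Fin a → ℂ)), x z))
      (LinearMap.prodEquiv ℂ).toLinearMap
      (isMorphismAt_affineSpace_prod_iff.2 ⟨isMorphismAt_const LinearMap.id z, hx⟩)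
  have h3 : S.IsMorphismAt (affineSpace _) (fun z => graphMap e (φ z).2) z :=
    (isMorphismAt_const e.symm.toLinearMap z).linearMapComp (hprod h2)
  refine isMorphismAt_flag_iff.2 ⟨?_, Gr.isMorphismAt_span _ h3⟩
  exact Gr.isMorphismAt_span _ (h3.linearMapComp
    ((isMorphismAt_const r.symm.toLinearMap z).linearMapComp (hprod h1)))

theorem isMorphismAt_flagCoord [FiniteDimensional ℂ V] {p : Flag₂ V m l}
    (hp : p ∈ flagChart r e) :
    (Flag₂.space V m l).IsMorphismAt (affineSpace _) (flagCoord r e) p := by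
  obtain ⟨h1, h2⟩ := isMorphismAt_flag_iff.1 (isMorphismAt_id (Flag₂.space V m l) p)
  have h3 := IsMorphismAt.comp (φ := fun p : Flag₂ V m l => p.1.1) (Gr.isMorphismAt_sect hp.1) h1
  have h4 := IsMorphismAt.comp (φ := fun p : Flag₂ V m l => p.1.2) (Gr.isMorphismAt_sect hp.2) h2
  refine isMorphismAt_affineSpace_prod_iff.2 ⟨?_, ?_⟩
  · exact h3.linear (LinearMap.llcomp ℂ _ _ _
      (LinearMap.snd ℂ _ _ ∘ₗ r.toLinearMap ∘ₗ coordSnd e))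
  · exact h4.linear (LinearMap.llcomp ℂ _ _ _ (LinearMap.snd ℂ _ _ ∘ₗ e.toLinearMap))

/-! ### Trivializations of `Ñ` -/

/-- The fiber coordinates of a point of `Ñ`. -/
def nTildeCoord :
    HomPair V m s →ₗ[ℂ] ((Fin m → ℂ) →ₗ[ℂ] (Fin m → ℂ)) × ((Fin s → ℂ) →ₗ[ℂ] (Fin s → ℂ)) :=
  -- `B` is projected to `ℂᵐ`, and `A` is restricted to the complement `0 × ℂˢ` of `U₂`.
  LinearMap.prod (LinearMap.llcomp ℂ _ _ _ (coordFst r e) ∘ₗ LinearMap.snd ℂ _ _)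
    ((LinearMap.llcomp ℂ _ _ _).flip (e.symm.toLinearMap ∘ₗ LinearMap.inr ℂ _ _) ∘ₗ
      LinearMap.fst ℂ _ _)

/-- The point of `Ñ` over a flag with given fiber coordinates. -/
noncomputable def nTildeParam (p : flagChart r e)
    (c : ((Fin m → ℂ) →ₗ[ℂ] (Fin m → ℂ)) × ((Fin s → ℂ) →ₗ[ℂ] (Fin s → ℂ))) :
    NTilde V m s m l :=
  ((NTilde.fiberEquiv V m s m l p.1).symm
    -- The difference in the next line is the projection of `V` onto `0 × ℂˢ` along `U₂`; hence this
    -- map kills `U₂` and equals `c.2` on the complement.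
    ⟨(c.2 ∘ₗ (LinearMap.snd ℂ _ _ ∘ₗ e.toLinearMap) ∘ₗ
        (LinearMap.id - Gr.sect (coordSnd e) p.1.1.2 ∘ₗ coordSnd e),
      Gr.sect (coordFst r e) p.1.1.1 ∘ₗ c.1), by
      refine ⟨?_, fun u hu => ?_⟩
      · rintro _ ⟨v, rfl⟩
        exact Gr.sect_mem p.2.1 _
      · have := Gr.sect_apply p.2.2 hu
        rw [LinearMap.mem_ker]
        simp [this]⟩).1

theorem nTildeCoord_nTildeParam (p : flagChart r e)
    (c : ((Fin m → ℂ) →ₗ[ℂ] (Fin m → ℂ)) × ((Fin s → ℂ) →ₗ[ℂ] (Fin s → ℂ))) :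
    nTildeCoord r e (nTildeParam r e p c).1.1.1 = c := by
  refine Prod.ext (LinearMap.ext fun v => ?_) (LinearMap.ext fun v => ?_)
  · exact Gr.apply_sect p.2.1 _
  · change c.2 (e (e.symm (0, v) - Gr.sect (coordSnd e) p.1.1.2 (e (e.symm (0, v))).1)).2 = c.2 v
    simp

/-- Since `A` kills `U₂`, it is determined on the complement `0 × ℂˢ`; since `B` has values in `U₁`,
it is recovered from its projection to `ℂᵐ` by the section. -/
theorem nTildeParam_nTildeCoord (x : NTilde V m s m l) (hx : x.1.2 ∈ flagChart r e) :
    nTildeParam r e ⟨x.1.2, hx⟩ (nTildeCoord r e x.1.1.1) = x := by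
  refine Subtype.ext (Prod.ext (Subtype.ext (Prod.ext (LinearMap.ext fun v => ?_)
    (LinearMap.ext fun v => ?_))) rfl)
  · let w := v - Gr.sect (coordSnd e) x.1.2.1.2 (coordSnd e v)
    have hw : (e w).1 = 0 := by
      have h1 : coordSnd e w = 0 := by
        rw [map_sub, Gr.apply_sect hx.2, sub_self]
      exact h1
    have h2 : e.symm (0, (e w).2) = w := by
      rw [LinearEquiv.symm_apply_eq]
      exact Prod.ext hw.symm rfl
    change x.1.1.1.1 (e.symm (0, (e w).2)) = x.1.1.1.1 v
    rw [h2, map_sub, LinearMap.mem_ker.1 (x.2.2 (Gr.sect_mem hx.2 _)), sub_zero]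
  · exact Gr.sect_apply hx.1 (x.2.1 ⟨v, rfl⟩)

theorem isMorphismAt_nTildeCoord [FiniteDimensional ℂ V] (x : NTilde V m s m l) :
    (NTilde.space V m s m l).IsMorphismAt (affineSpace _)
      (fun x => nTildeCoord r e x.1.1.1) x := by
  obtain ⟨⟨h1, h2⟩, -⟩ := isMorphismAt_nTilde_iff.1 (isMorphismAt_id (NTilde.space V m s m l) x)
  exact (isMorphismAt_affineSpace_prod_iff.2 ⟨h1, h2⟩).linear (nTildeCoord r e)

theorem isMorphismAt_nTildeParam [FiniteDimensional ℂ V] {φ : Z → flagChart r e}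
    {c : Z → ((Fin m → ℂ) →ₗ[ℂ] (Fin m → ℂ)) × ((Fin s → ℂ) →ₗ[ℂ] (Fin s → ℂ))}
    (hφ : S.IsMorphismAt (Flag₂.space V m l) (fun z => (φ z).1) z)
    (hc : S.IsMorphismAt (affineSpace _) c z) :
    S.IsMorphismAt (NTilde.space V m s m l) (fun z => nTildeParam r e (φ z) (c z)) z := by
  obtain ⟨h1, h2⟩ := isMorphismAt_flag_iff.1 hφ
  obtain ⟨hc1, hc2⟩ := isMorphismAt_affineSpace_prod_iff.1 hc
  have h3 := IsMorphismAt.comp (φ := fun z => (φ z).1.1.1) (Gr.isMorphismAt_sect (φ z).2.1) h1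
  have h4 := IsMorphismAt.comp (φ := fun z => (φ z).1.1.2) (Gr.isMorphismAt_sect (φ z).2.2) h2
  refine isMorphismAt_nTilde_iff.2 ⟨⟨?_, h3.linearMapComp hc1⟩, hφ⟩
  exact hc2.linearMapComp ((isMorphismAt_const _ z).linearMapComp
    ((isMorphismAt_const _ z).sub (h4.linearMapComp (isMorphismAt_const _ z))))

/-- Finitely many charts cover the flag variety. -/
theorem exists_finite_flagChart_cover [FiniteDimensional ℂ V]
    (hV : Module.finrank ℂ V = m + k + s) (hl : l = m + k) :
    ∃ (ι : Type) (_ : Finite ι) (e : ι → V ≃ₗ[ℂ] (Fin l → ℂ) × (Fin s → ℂ)),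
      ∀ p : Flag₂ V m l, ∃ i, p ∈ flagChart r (e i) := by
  let β := Module.finBasisOfFinrankEq ℂ V hV
  let W (J : Finset (Fin (m + k + s))) : Submodule ℂ V := Submodule.span ℂ (β '' J)
  -- Charts are indexed by nested pairs of coordinate subspaces of one basis, of the right
  -- dimensions: a finite set.
  let ι := {J : Finset (Fin (m + k + s)) × Finset (Fin (m + k + s)) //
    W J.2 ≤ W J.1 ∧ Module.finrank ℂ (W J.1) = k + s ∧ Module.finrank ℂ (W J.2) = s}
  choose e he₂ he₁ using fun i : ι => exists_equiv_adapted r i.2.1 hV i.2.2.1 i.2.2.2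
  refine ⟨ι, inferInstance, e, fun p => ?_⟩
  -- The complement of `U₂` is found first. It also meets the smaller `U₁` trivially, so it can be
  -- enlarged to a complement of `U₁`, which makes the two complements nested.
  obtain ⟨J₂, -, hJ₂⟩ := exists_finset_isCompl_span β p.1.2.1 ∅ (by simp)
  obtain ⟨J₁, hJ, hJ₁⟩ := exists_finset_isCompl_span β p.1.1.1 J₂ (hJ₂.1.mono_left p.2)
  have h₁ : m + Module.finrank ℂ (W J₁) = m + k + s := by
    have h := Submodule.finrank_add_eq_of_isCompl hJ₁
    rwa [p.1.1.2, hV] at h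
  have h₂ : l + Module.finrank ℂ (W J₂) = m + k + s := by
    have h := Submodule.finrank_add_eq_of_isCompl hJ₂
    rwa [p.1.2.2, hV] at h
  have h₁' : Module.finrank ℂ (W J₁) = k + s := by omega
  have h₂' : Module.finrank ℂ (W J₂) = s := by omega
  refine ⟨⟨(J₁, J₂), Submodule.span_mono (Set.image_mono hJ), h₁', h₂'⟩, ?_, ?_⟩
  · exact Gr.mem_chart_of_disjoint (hJ₁.1.mono_right fun v hv => he₁ _ v hv)
  · exact Gr.mem_chart_of_disjoint (hJ₂.1.mono_right fun v hv => he₂ _ v hv)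

end Charts

/-! ### The main results -/

section Main

variable {V : Type*} [AddCommGroup V] [Module ℂ V] {m k l s : ℕ}

/-- The map `(A, B) ↦ (B, A)` from pairs of homomorphisms to tensors. -/
noncomputable def homPairToTensor (V : Type*) [AddCommGroup V] [Module ℂ V] (m s : ℕ) :
    HomPair V m s →ₗ[ℂ] ((Fin m → ℂ) ⊗[ℂ] V) × ((Fin s → ℂ) ⊗[ℂ] Module.Dual ℂ V) :=
  LinearMap.prod ((homEquivTensor V m).toLinearMap ∘ₗ LinearMap.snd ℂ _ _)
    ((homEquivTensorDual V s).toLinearMap ∘ₗ LinearMap.fst ℂ _ _)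

/-- The fiberwise linear isomorphism of `Ñ` with `𝒦`. -/
noncomputable def nTildeEquivBundleK (V : Type*) [AddCommGroup V] [Module ℂ V] (m k l s : ℕ) :
    NTilde V m s k l ≃ TotalSpace (bundleK V m s k l) where
  toFun x := ⟨(homPairToTensor V m s x.1.1.1, x.1.2),
    (homEquivTensor_mem_iff _ _ _).2 x.2.1, (homEquivTensorDual_mem_iff _ _).2 x.2.2⟩
  invFun y := ((NTilde.fiberEquiv V m s k l y.1.2).symm
    ⟨((homEquivTensorDual V s).symm y.1.1.2, (homEquivTensor V m).symm y.1.1.1), by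
      refine ⟨(homEquivTensor_mem_iff (taut V k l) _ _).1 ?_,
        (homEquivTensorDual_mem_iff _ _).1 ?_⟩
      · rw [LinearEquiv.apply_symm_apply]
        exact y.2.1
      · rw [LinearEquiv.apply_symm_apply]
        exact y.2.2⟩).1
  left_inv x := Subtype.ext (Prod.ext (Subtype.ext (Prod.ext
    ((homEquivTensorDual V s).symm_apply_apply _) ((homEquivTensor V m).symm_apply_apply _))) rfl)
  right_inv y := Subtype.ext (Prod.ext (Prod.ext
    ((homEquivTensor V m).apply_symm_apply _) ((homEquivTensorDual V s).apply_symm_apply _)) rfl)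

/-- In both directions the map is a fixed linear map on the ambient space times the identity on
flags, so regularity and linearity are inherited from it. -/
theorem isVectorBundleIso_nTildeEquivBundleK :
    IsVectorBundleIso (NTilde.space V m s k l)
      (TotalSpace.space (bundleK V m s k l) (Flag₂.space V k l))
      (NTilde.proj V m s k l) (TotalSpace.proj (bundleK V m s k l))
      (nTildeEquivBundleK V m k l s) := by
  refine ⟨⟨isMorphism_iff.2 fun x => isMorphismAt_induced_iff.2 ?_,
    isMorphism_iff.2 fun y => isMorphismAt_nTilde_iff.2 ?_⟩, fun _ => rfl, fun b => ⟨?_, ?_⟩⟩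
  · obtain ⟨⟨h1, h2⟩, h3⟩ := isMorphismAt_nTilde_iff.1 (isMorphismAt_id (NTilde.space V m s k l) x)
    exact (isMorphismAt_affineSpace_prod_iff.2 ⟨h2.linear (homEquivTensor V m).toLinearMap,
      h1.linear (homEquivTensorDual V s).toLinearMap⟩).prodMk h3
  · obtain ⟨h1, h2⟩ := isMorphismAt_prod_iff.1 (isMorphismAt_induced (T := (affineSpace
      (((Fin m → ℂ) ⊗[ℂ] V) × ((Fin s → ℂ) ⊗[ℂ] Module.Dual ℂ V))).prod (Flag₂.space V k l))
      (Subtype.val : TotalSpace (bundleK V m s k l) → _) y)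
    obtain ⟨h3, h4⟩ := isMorphismAt_affineSpace_prod_iff.1 h1
    exact ⟨⟨h4.linear (homEquivTensorDual V s).symm.toLinearMap,
      h3.linear (homEquivTensor V m).symm.toLinearMap⟩, h2⟩
  · intro z w
    -- The operations on fibers are transported along `fiberEquiv`, so linearity is checked in the
    -- ambient vector spaces.
    refine (TotalSpace.fiberEquiv (bundleK V m s k l) b).injective (Subtype.ext ?_)
    refine Eq.trans ?_ (congrArg Subtype.val
      (((TotalSpace.fiberEquiv (bundleK V m s k l) b).linearEquiv ℂ).map_add _ _)).symm
    exact (congrArg (fun c => homPairToTensor V m s c.1)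
      (((NTilde.fiberEquiv V m s k l b).linearEquiv ℂ).map_add z w)).trans (map_add _ _ _)
  · intro c z
    refine (TotalSpace.fiberEquiv (bundleK V m s k l) b).injective (Subtype.ext ?_)
    refine Eq.trans ?_ (congrArg Subtype.val
      (((TotalSpace.fiberEquiv (bundleK V m s k l) b).linearEquiv ℂ).map_smul _ _)).symm
    exact (congrArg (fun c => homPairToTensor V m s c.1)
      (((NTilde.fiberEquiv V m s k l b).linearEquiv ℂ).map_smul c z)).trans (map_smul _ _ _)

theorem isVectorBundle_nTilde [FiniteDimensional ℂ V] (hV : Module.finrank ℂ V = m + k + s)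
    (hl : l = m + k) : IsVectorBundle (NTilde.space V m s m l) (Flag₂.space V m l)
      (NTilde.proj V m s m l) (m ^ 2 + s ^ 2) := by
  let r : (Fin l → ℂ) ≃ₗ[ℂ] (Fin m → ℂ) × (Fin k → ℂ) :=
    LinearEquiv.ofFinrankEq _ _ (by simp [hl])
  -- The rank is the dimension of `End(ℂᵐ) × End(ℂˢ)`.
  let L : (((Fin m → ℂ) →ₗ[ℂ] (Fin m → ℂ)) × ((Fin s → ℂ) →ₗ[ℂ] (Fin s → ℂ))) ≃ₗ[ℂ]
      (Fin (m ^ 2 + s ^ 2) → ℂ) :=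
    LinearEquiv.ofFinrankEq _ _ (by simp [Module.finrank_linearMap, sq])
  obtain ⟨ι, -, e, he⟩ := exists_finite_flagChart_cover (V := V) r hV hl
  intro p
  obtain ⟨i, hp⟩ := he p
  obtain ⟨ψ, hψ, hψ2⟩ := isIsomorphism_trivialization (isMorphism_nTilde_proj (V := V) (s := s))
    (U := flagChart r (e i)) (fun x => L (nTildeCoord r (e i) x.1.1.1))
    (fun q => nTildeParam r (e i) q.1 (L.symm q.2))
    (fun x _ => (isMorphismAt_nTildeCoord r (e i) x).linear L.toLinearMap)
    (isMorphism_iff.2 fun q => isMorphismAt_nTildeParam r (e i)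
      ((isMorphismAt_induced _ _).comp (isMorphismAt_fst _ _ q))
      ((isMorphismAt_snd _ _ q).linear L.symm.toLinearMap))
    (fun q => rfl) (fun q => by simp [nTildeCoord_nTildeParam])
    (fun x hx => by
      rw [LinearEquiv.symm_apply_apply]
      exact nTildeParam_nTildeCoord r (e i) x hx)
  refine ⟨flagChart r (e i), hp, isOpen_flagChart r (e i), ψ, hψ, fun x => (hψ2 x).1,
    fun b hb => ?_⟩
  simp only [(hψ2 _).2]
  exact ((L.toLinearMap ∘ₗ nTildeCoord r (e i) ∘ₗ
    (NTilde.fiberSubmodule V m s m l b).subtype) ∘ₗ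
      ((NTilde.fiberEquiv V m s m l b).linearEquiv ℂ).toLinearMap).isLinear

theorem isSmoothVarietyOfDim_nTilde [FiniteDimensional ℂ V]
    (hV : Module.finrank ℂ V = m + k + s) (hl : l = m + k) :
    (NTilde.space V m s m l).IsSmoothVarietyOfDim (m * k + l * s + (m ^ 2 + s ^ 2)) := by
  let r : (Fin l → ℂ) ≃ₗ[ℂ] (Fin m → ℂ) × (Fin k → ℂ) :=
    LinearEquiv.ofFinrankEq _ _ (by simp [hl])
  -- The dimension is that of the flag coordinates, `mk + ls`, plus that of the fiber, `m² + s²`.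
  let L : ((((Fin m → ℂ) →ₗ[ℂ] (Fin k → ℂ)) × ((Fin l → ℂ) →ₗ[ℂ] (Fin s → ℂ))) ×
      (((Fin m → ℂ) →ₗ[ℂ] (Fin m → ℂ)) × ((Fin s → ℂ) →ₗ[ℂ] (Fin s → ℂ)))) ≃ₗ[ℂ]
      (Fin (m * k + l * s + (m ^ 2 + s ^ 2)) → ℂ) :=
    LinearEquiv.ofFinrankEq _ _ (by simp [Module.finrank_linearMap, sq])
  obtain ⟨ι, _, e, he⟩ := exists_finite_flagChart_cover (V := V) r hV hl
  -- Any coordinates prove nonemptiness: they give a point with `A = 0` and `B = 0`.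
  let e₀ : V ≃ₗ[ℂ] (Fin l → ℂ) × (Fin s → ℂ) :=
    LinearEquiv.ofFinrankEq _ _ (by simp [hV, hl])
  have : Nonempty (NTilde V m s m l) := ⟨nTildeParam r e₀ ⟨_, flagParam_mem r e₀ 0⟩ 0⟩
  refine isSmoothVarietyOfDim_of_charts isSeparated_nTilde _
    (fun i => NTilde.proj V m s m l ⁻¹' flagChart r (e i)) (fun i => ?_) (fun x => he _)
    (fun i a => nTildeParam r (e i) ⟨_, flagParam_mem r (e i) (L.symm a).1⟩ (L.symm a).2)
    (fun i x => L (flagCoord r (e i) x.1.2, nTildeCoord r (e i) x.1.1.1))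
    (fun i => ?_) (fun i x hx => ?_) (fun i a => flagParam_mem r (e i) _) (fun i a => ?_)
    (fun i x hx => ?_)
  · exact @IsOpen.preimage _ _ (_) (_) _ isMorphism_nTilde_proj.1 _ (isOpen_flagChart r (e i))
  · refine isMorphism_iff.2 fun a => ?_
    obtain ⟨h1, h2⟩ := isMorphismAt_affineSpace_prod_iff.1
      ((isMorphismAt_id (affineSpace _) a).linear L.symm.toLinearMap)
    exact isMorphismAt_nTildeParam r (e i) (isMorphismAt_flagParam r (e i) h1) h2
  · have h1 := (isMorphismAt_flagCoord r (e i) hx).comp (isMorphism_nTilde_proj.at x)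
    exact (isMorphismAt_affineSpace_prod_iff.2
      ⟨h1, isMorphismAt_nTildeCoord r (e i) x⟩).linear L.toLinearMap
  · rw [nTildeCoord_nTildeParam]
    change L (flagCoord r (e i) (flagParam r (e i) (L.symm a).1), (L.symm a).2) = a
    rw [flagCoord_flagParam]
    exact L.apply_symm_apply a
  · have h1 : (⟨flagParam r (e i) (flagCoord r (e i) x.1.2), flagParam_mem r (e i) _⟩ :
        flagChart r (e i)) = ⟨x.1.2, hx⟩ := Subtype.ext (flagParam_flagCoord r (e i) hx)
    simp only [LinearEquiv.symm_apply_apply, h1]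
    exact nTildeParam_nTildeCoord r (e i) x hx

end Main

theorem mainTheorem6 {V : Type*} [AddCommGroup V] [Module ℂ V] [FiniteDimensional ℂ V]
    (n m s : ℕ) (hV : Module.finrank ℂ V = n) (hn : s + m ≤ n) :
    IsVectorBundle (NTilde.space V m s m (n - s)) (Flag₂.space V m (n - s))
      (NTilde.proj V m s m (n - s)) (m ^ 2 + s ^ 2) ∧
    IsVectorBundle (TotalSpace.space (bundleK V m s m (n - s)) (Flag₂.space V m (n - s)))
      (Flag₂.space V m (n - s)) (TotalSpace.proj (bundleK V m s m (n - s))) (m ^ 2 + s ^ 2) ∧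
    (∃ Φ : NTilde V m s m (n - s) ≃ TotalSpace (bundleK V m s m (n - s)),
      IsVectorBundleIso (NTilde.space V m s m (n - s))
        (TotalSpace.space (bundleK V m s m (n - s)) (Flag₂.space V m (n - s)))
        (NTilde.proj V m s m (n - s)) (TotalSpace.proj (bundleK V m s m (n - s))) Φ) ∧
    (NTilde.space V m s m (n - s)).IsSmoothVarietyOfDim (s * n + m * n - s * m) := by
  -- `k = n - s - m` is the dimension of `U₂/U₁`.
  obtain ⟨k, rfl⟩ := Nat.exists_eq_add_of_le hn
  have hV' : Module.finrank ℂ V = m + k + s := by lia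
  have hl : s + m + k - s = m + k := by lia
  have h := isVectorBundle_nTilde hV' hl
  refine ⟨h, h.of_iso isVectorBundleIso_nTildeEquivBundleK,
    ⟨_, isVectorBundleIso_nTildeEquivBundleK⟩, ?_⟩
  convert isSmoothVarietyOfDim_nTilde hV' hl using 1
  rw [hl]
  -- The truncated subtraction of `s * m` is traded for an identity of sums.
  refine Nat.sub_eq_of_eq_add ?_
  ring
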